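/- Let $\Omega=(0,2\pi)\times(0,2\pi)$, $J(f,g)=\partial_xf\,\partial_yg-\partial_yf\,\partial_xg$, $\psi_0=\sin x\sin y$, $\beta_{n,m}=\frac{n^2+m^2}{4}$, and let $H^4$ be the real Hilbert space of all series $\psi=\sum_{n,m\ge1}a_{n,m}\sin\frac{nx}{2}\sin\frac{my}{2}$ with $\|\psi\|_{H^4}^2=\sum_{n,m\ge1}(1+\beta_{n,m}^2)^2|a_{n,m}|^2<\infty$. Let $E_1,E_2,E_3\subset H^4$ be the subspaces of those $\psi$ that involve only modes with, respectively, $n,m$ both odd; $n$ odd and $m$ even; $n$ even and $m$ odd. Let $\nu_c>0$, $\mu_c\ge0$, and let $0\neq\psi_c\in E_1\cup E_2\cup E_3$ be a critical eigenfunction (eigenvalue $\lambda=0$) of the linearized problem, that is, $$0=-\mu_c\Delta\psi_c+\nu_c\Delta^2\psi_c+J(\psi_0,(2+\Delta)\psi_c)\quad\text{in }\Omega .$$ Let $Z$ be any closed complement of $\operatorname{span}\{\psi_c\}$ in $H^4$ (for instance the orthogonal complement), representing $H^4/\operatorname{span}\{\psi_c\}$. Then there are $a>0$ and continuous functions $\kappa:(-a,a)\to\mathbb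 R$ and $\Psi:(-a,a)\to Z$ with $\kappa(0)=0$ and $\Psi(0)=0$ such that, for every $\epsilon\in(-a,a)$, $$\psi=\psi_0+\epsilon\psi_c+\epsilon\Psi(\epsilon),\qquad \nu=\nu_c+\nu_c\kappa(\epsilon),\qquad \mu=\mu_c+\mu_c\kappa(\epsilon)$$ is a steady solution of $$J(\psi,\Delta\psi)+(-\mu\Delta+\nu\Delta^2)(\psi-\sin x\sin y)=0\ \text{ in }\Omega,\qquad \psi=\Delta\psi=0\ \text{ on }\partial\Omega .$$ -/

import Mathlib

open MeasureTheory Set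
open scoped ContDiff

namespace VortexFlow

/-- The fluid domain `Ω = (0, 2π) × (0, 2π)`. -/
def Ω : Set (ℝ × ℝ) := Ioo 0 (2 * Real.pi) ×ˢ Ioo 0 (2 * Real.pi)

/-- The basic stream function `ψ₀ = sin x sin y`. -/
noncomputable def psi0 (p : ℝ × ℝ) : ℝ := Real.sin p.1 * Real.sin p.2

/-! ### The Hilbert space `H⁴` of sine series -/

/-- `β_{n,m} = (n² + m²) / 4`, so that `-Δ` acts on `sin (n x / 2) sin (m y / 2)` as
multiplication by `β_{n,m}`. -/
noncomputable def beta (k : ℕ+ × ℕ+) : ℝ := (((k.1 : ℕ) : ℝ) ^ 2 + ((k.2 : ℕ) : ℝ) ^ 2) / 4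

/-- The mode `sin (n x / 2) sin (m y / 2)`, `n, m ≥ 1`. -/
noncomputable def mode (k : ℕ+ × ℕ+) (p : ℝ × ℝ) : ℝ :=
  Real.sin (((k.1 : ℕ) : ℝ) * p.1 / 2) * Real.sin (((k.2 : ℕ) : ℝ) * p.2 / 2)

/-- The Hilbert space `H⁴` of the series `ψ = ∑_{n,m ≥ 1} a_{n,m} sin (n x / 2) sin (m y / 2)`
with `‖ψ‖² = ∑ (1 + β_{n,m}²)² a_{n,m}² < ∞`. An element is stored as the square-summable
family `(1 + β_{n,m}²) a_{n,m}`, so that the `ℓ²` norm (and inner product) is the one of `H⁴`;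
see `norm_sq_eq` and `exists_coeff_eq`. -/
abbrev H4 : Type := lp (fun _ : ℕ+ × ℕ+ => ℝ) 2

/-- The Fourier coefficient `a_{n,m}` of `ψ`. -/
noncomputable def coeff (ψ : H4) (k : ℕ+ × ℕ+) : ℝ := ψ k / (1 + beta k ^ 2)

/-- The function `ψ(x, y) = ∑ a_{n,m} sin (n x / 2) sin (m y / 2)` represented by `ψ ∈ H⁴`
(the series converges absolutely at every point). -/
noncomputable def toFun (ψ : H4) (p : ℝ × ℝ) : ℝ := ∑' k, coeff ψ k * mode k p

theorem one_add_beta_sq_pos (k : ℕ+ × ℕ+) : 0 < 1 + beta k ^ 2 := by positivity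

theorem norm_sq_eq (ψ : H4) : ‖ψ‖ ^ 2 = ∑' k, (1 + beta k ^ 2) ^ 2 * coeff ψ k ^ 2 := by
  have h := lp.norm_rpow_eq_tsum (p := 2) (by norm_num) ψ
  simp only [ENNReal.toReal_ofNat, Real.rpow_ofNat, Real.norm_eq_abs, sq_abs] at h
  rw [h]
  refine tsum_congr fun k => ?_
  have := (one_add_beta_sq_pos k).ne'
  simp only [coeff]
  field_simp

theorem exists_coeff_eq (a : ℕ+ × ℕ+ → ℝ)
    (ha : Summable fun k => (1 + beta k ^ 2) ^ 2 * a k ^ 2) :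
    ∃ ψ : H4, ∀ k, coeff ψ k = a k := by
  refine ⟨⟨fun k => (1 + beta k ^ 2) * a k, memℓp_gen ?_⟩, fun k => ?_⟩
  · simpa [mul_pow] using ha
  · have := (one_add_beta_sq_pos k).ne'
    simp only [coeff]
    field_simp

/-- `ψ` has no other modes than those with `n, m` odd. -/
def E1 : Set H4 := {ψ | ∀ k : ℕ+ × ℕ+, ¬ (Odd (k.1 : ℕ) ∧ Odd (k.2 : ℕ)) → coeff ψ k = 0}

/-- `ψ` has no other modes than those with `n` odd and `m` even. -/
def E2 : Set H4 := {ψ | ∀ k : ℕ+ × ℕ+, ¬ (Odd (k.1 : ℕ) ∧ Even (k.2 : ℕ)) → coeff ψ k = 0}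

/-- `ψ` has no other modes than those with `n` even and `m` odd. -/
def E3 : Set H4 := {ψ | ∀ k : ℕ+ × ℕ+, ¬ (Even (k.1 : ℕ) ∧ Odd (k.2 : ℕ)) → coeff ψ k = 0}

/-! ### Derivatives in `L²(Ω)` -/

/-- `g ∈ L²(Ω)` is the weak derivative of `f ∈ L²(Ω)` in the direction `v`. -/
def HasWeakPartial (v : ℝ × ℝ) (f g : ℝ × ℝ → ℝ) : Prop :=
  MemLp f 2 (volume.restrict Ω) ∧ MemLp g 2 (volume.restrict Ω) ∧
    ∀ φ : ℝ × ℝ → ℝ, ContDiff ℝ ∞ φ → HasCompactSupport φ → tsupport φ ⊆ Ω →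
      ∫ p in Ω, f p * fderiv ℝ φ p v = - ∫ p in Ω, g p * φ p

/-- `g = Δ f = ∂ₓ ∂ₓ f + ∂_y ∂_y f` in the sense of weak derivatives in `L²(Ω)`. -/
def HasWeakLaplacian (f g : ℝ × ℝ → ℝ) : Prop :=
  ∃ fx fy fxx fyy : ℝ × ℝ → ℝ,
    HasWeakPartial (1, 0) f fx ∧ HasWeakPartial (1, 0) fx fxx ∧
    HasWeakPartial (0, 1) f fy ∧ HasWeakPartial (0, 1) fy fyy ∧
    ∀ᵐ p ∂volume.restrict Ω, g p = fxx p + fyy p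

/-- `j = J(f, g) = ∂ₓ f ∂_y g - ∂_y f ∂ₓ g`, with weak derivatives in `L²(Ω)`. -/
def HasJacobian (f g j : ℝ × ℝ → ℝ) : Prop :=
  ∃ fx fy gx gy : ℝ × ℝ → ℝ,
    HasWeakPartial (1, 0) f fx ∧ HasWeakPartial (0, 1) f fy ∧
    HasWeakPartial (1, 0) g gx ∧ HasWeakPartial (0, 1) g gy ∧
    ∀ᵐ p ∂volume.restrict Ω, j p = fx p * gy p - fy p * gx p

/-! ### The spectral problem and the steady flow problem -/

/-- `(lam, ψ, ν, μ)` solves the spectral problem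
`lam Δψ = -μ Δψ + ν Δ²ψ + J(ψ₀, (2 + Δ)ψ)`, `0 ≠ ψ ∈ H⁴`. -/
def IsSpectralSolution (lam : ℝ) (ψ : H4) (ν μ : ℝ) : Prop :=
  ψ ≠ 0 ∧ ∃ w h j : ℝ × ℝ → ℝ,
    HasWeakLaplacian (toFun ψ) w ∧ HasWeakLaplacian w h ∧
    HasJacobian psi0 (fun p => 2 * toFun ψ p + w p) j ∧
    ∀ᵐ p ∂volume.restrict Ω, lam * w p = -μ * w p + ν * h p + j p

/-- `ψ` is a steady solution, with parameters `ν` and `μ`, of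
`J(ψ, Δψ) + (-μ Δ + ν Δ²)(ψ - sin x sin y) = 0` in `Ω`, `ψ = Δψ = 0` on `∂Ω`.
Here `w = Δψ` is represented by a function that is continuous up to the boundary. -/
def IsSteadySolution (ψ : ℝ × ℝ → ℝ) (ν μ : ℝ) : Prop :=
  ContinuousOn ψ (closure Ω) ∧ (∀ p ∈ frontier Ω, ψ p = 0) ∧
  ∃ w g h j : ℝ × ℝ → ℝ,
    HasWeakLaplacian ψ w ∧ ContinuousOn w (closure Ω) ∧ (∀ p ∈ frontier Ω, w p = 0) ∧
    HasJacobian ψ w j ∧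
    HasWeakLaplacian (fun p => ψ p - psi0 p) g ∧ HasWeakLaplacian g h ∧
    ∀ᵐ p ∂volume.restrict Ω, j p + (-μ * g p + ν * h p) = 0

end VortexFlow

open VortexFlow

/-! Write `A = -μ_c Δ + ν_c Δ²` and `L φ = J(ψ₀, (2 + Δ)φ)`. Since `Δψ₀ = -2ψ₀`, the substitution `ψ
= ψ₀ + εφ`, with both coefficients multiplied by `1 + κ`, reduces the steady equation after division
by `ε` to `(1 + κ) Aφ + Lφ + ε J(φ, Δφ) = 0` with `φ = ψ_c + Ψ`. The Jacobian costs fewer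
derivatives than `A⁻¹` restores, so `A⁻¹L` is compact. By the Fredholm alternative the linearisation
at `ε = 0` in the unknowns `(Ψ, κ)`, with `Ψ ∈ Z`, is an isomorphism once it is injective, and the
inverse function theorem gives the branch (`exists_bifurcation_branch`).

Injectivity means a simple kernel and transversality. Advection by `ψ₀` is skew, so `⟪Lφ, (2 + Δ)χ⟫`
is antisymmetric (`inner_advect_antisymm`) and every kernel element satisfies `q(φ) = ⟪Aφ, (2 + Δ)φ⟫
= 0`. The work takes place in a class of modes that is closed under the Jacobian and contains `ψ_c`.
In it only one mode `k₀` has `β < 2`, and `β = 2` only at the mode of `ψ₀`, which `2 + Δ`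
annihilates. Hence `q` is negative definite modulo `ψ₀` on functions without the mode `k₀`, and a
kernel element is determined by its `k₀` coefficient (`eq_zero_of_kernel`).

For transversality, each class has a signed involution `T` of the modes that commutes with `A`,
anticommutes with `L` and fixes `k₀`. Then `(2 + Δ)Tψ_c` annihilates the range of `A + L`, and what
is needed is `⟪Aψ_c, (2 + Δ)Tψ_c⟫ ≠ 0` (`inner_viscous_T_ne_zero`). If this vanished, `q` would
vanish on `ψ_c - Tψ_c`, which has no `k₀` mode; so `Tψ_c = ψ_c`. Together with anticommutation this
gives `Aψ_c = 0`, hence `ψ_c = 0`. -/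

namespace VortexFlow

open Filter Topology
open scoped BoundedContinuousFunction RealInnerProductSpace

/-! ### Operators on square-summable families -/

theorem H4.norm_le_of_abs_le {a ψ : H4} {C : ℝ} (hC : 0 ≤ C) (h : ∀ k, |a k| ≤ C * |ψ k|) :
    ‖a‖ ≤ C * ‖ψ‖ := by
  have : ‖C • ψ‖ = C * ‖ψ‖ := by rw [norm_smul, Real.norm_eq_abs, abs_of_nonneg hC]
  rw [← this]
  refine lp.norm_mono (by norm_num) fun k => ?_
  simpa [abs_mul, abs_of_nonneg hC] using h k

/-- The multiplier with bounded symbol `f`. -/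
noncomputable def diag (f : ℕ+ × ℕ+ → ℝ) (h : ∃ C, ∀ k, |f k| ≤ C) : H4 →L[ℝ] H4 :=
  -- The absolute value only serves to make the chosen bound visibly nonnegative.
  lp.mapCLM 2 (fun k => (f k) • ContinuousLinearMap.id ℝ ℝ) (K := |h.choose|) (abs_nonneg _)
    fun k => by
      refine (norm_smul_le _ _).trans ?_
      have h1 : ‖ContinuousLinearMap.id ℝ ℝ‖ ≤ 1 := ContinuousLinearMap.norm_id_le
      calc ‖f k‖ * ‖ContinuousLinearMap.id ℝ ℝ‖ ≤ ‖f k‖ * 1 := by gcongr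
        _ ≤ _ := by
          rw [mul_one]
          exact (h.choose_spec k).trans (le_abs_self _)

@[simp]
theorem diag_apply (f : ℕ+ × ℕ+ → ℝ) (h : ∃ C, ∀ k, |f k| ≤ C) (ψ : H4) (k : ℕ+ × ℕ+) :
    diag f h ψ k = f k * ψ k := by
  simp [diag]

theorem diag_single (f : ℕ+ × ℕ+ → ℝ) (h : ∃ C, ∀ k, |f k| ≤ C) (k : ℕ+ × ℕ+) (r : ℝ) :
    diag f h (lp.single 2 k r) = lp.single 2 k (f k * r) := by
  ext l
  rw [diag_apply]
  by_cases hl : l = k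
  · subst hl; simp
  · simp [hl]

/-- The finite-rank truncations converge in operator norm, because the symbol exceeds any given size
at only finitely many modes. -/
theorem isCompactOperator_diag (f : ℕ+ × ℕ+ → ℝ) (h : ∃ C, ∀ k, |f k| ≤ C)
    (h0 : Tendsto f cofinite (𝓝 0)) : IsCompactOperator (diag f h) := by
  classical
  have hev : ∀ k : ℕ+ × ℕ+, ∃ e : H4 →L[ℝ] ℝ, ∀ ψ, e ψ = ψ k := fun k =>
    ⟨innerSL ℝ (lp.single 2 k (1 : ℝ)), fun ψ => by simp [lp.inner_single_left]⟩
  choose e he using hev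
  let R : ℕ+ × ℕ+ → H4 →L[ℝ] H4 := fun k => (e k).smulRight (lp.single 2 k (f k))
  have hR : ∀ k, IsCompactOperator (R k) := fun k => by
    have h1 : IsCompactOperator
        (ContinuousLinearMap.toSpanSingleton ℝ (lp.single 2 k (f k) : H4)) :=
      (isCompactOperator_id_iff_locallyCompactSpace.2 inferInstance).clm_comp
        (ContinuousLinearMap.toSpanSingleton ℝ (lp.single 2 k (f k) : H4))
    exact h1.comp_clm (e k)
  have hRa : ∀ k ψ l, R k ψ l = if l = k then f k * ψ k else 0 := fun k ψ l => by
    by_cases hl : l = k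
    · subst hl; simp [R, he, mul_comm]
    · simp [R, he, hl]
  have hsum : ∀ s : Finset (ℕ+ × ℕ+), IsCompactOperator (∑ k ∈ s, R k : H4 →L[ℝ] H4) := fun s => by
    have := Submodule.sum_mem (compactOperator (RingHom.id ℝ) H4 H4) (t := s)
      (f := R) (fun k _ => hR k)
    simpa [compactOperator] using this
  refine isCompactOperator_of_tendsto (l := atTop) (F := fun s : Finset (ℕ+ × ℕ+) => ∑ k ∈ s, R k)
    ?_ (Eventually.of_forall hsum)
  rw [tendsto_iff_norm_sub_tendsto_zero, Metric.tendsto_atTop]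
  intro ε hε
  have hfin : {k | ¬ |f k| < ε / 2}.Finite := by
    have := (Metric.tendsto_nhds.1 h0) (ε / 2) (half_pos hε)
    simpa [Filter.eventually_cofinite] using this
  refine ⟨hfin.toFinset, fun s hs => ?_⟩
  rw [dist_zero_right, norm_norm]
  refine lt_of_le_of_lt (ContinuousLinearMap.opNorm_le_bound _ (half_pos hε).le fun ψ => ?_)
    (half_lt_self hε)
  refine H4.norm_le_of_abs_le (half_pos hε).le fun l => ?_
  have hval : ((∑ k ∈ s, R k - diag f h) ψ) l = (if l ∈ s then 0 else - f l) * ψ l := by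
    have : ((∑ k ∈ s, R k) ψ) l = ∑ k ∈ s, R k ψ l := by
      rw [_root_.sum_apply, lp.coeFn_sum, Finset.sum_apply]
    rw [_root_.sub_apply, lp.coeFn_sub, Pi.sub_apply, this, diag_apply]
    simp only [hRa, Finset.sum_ite_eq]
    split_ifs <;> ring
  rw [hval, abs_mul]
  gcongr
  split_ifs with hl
  · simpa using (half_pos hε).le
  · have : l ∉ hfin.toFinset := fun hh => hl (hs hh)
    simp only [Finite.mem_toFinset, mem_ofPred_eq, not_not] at this
    simpa using this.le

/-- Finite combinations of modes are dense, so identities between continuous linear maps, and by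
iteration bilinear ones, need only be checked on modes. -/
theorem eq_of_apply_single {F : Type*} [NormedAddCommGroup F] [NormedSpace ℝ F]
    {f g : H4 →L[ℝ] F} (h : ∀ k, f (lp.single 2 k 1) = g (lp.single 2 k 1)) : f = g := by
  refine lp.ext_continuousLinearMap (by norm_num) fun k => ?_
  ext
  simpa using h k

theorem mem_of_apply_single {F : Type*} [NormedAddCommGroup F] [NormedSpace ℝ F]
    {f : H4 →L[ℝ] F} {S : Submodule ℝ F} (hS : IsClosed (S : Set F))
    (h : ∀ k, f (lp.single 2 k 1) ∈ S) (ψ : H4) : f ψ ∈ S := by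
  have h1 := (lp.hasSum_single (by norm_num) ψ).map f f.continuous
  refine hS.mem_of_tendsto h1 (Eventually.of_forall fun s => ?_)
  refine S.sum_mem fun k _ => ?_
  have : (lp.single 2 k (ψ k) : H4) = ψ k • lp.single 2 k (1 : ℝ) := by
    rw [← lp.single_smul]; simp
  simp only [Function.comp_apply, this, map_smul]
  exact S.smul_mem _ (h k)

/-! ### Weights -/

theorem one_le_natCast_pnat (n : ℕ+) : (1 : ℝ) ≤ ((n : ℕ) : ℝ) := by exact_mod_cast n.pos

theorem half_le_beta (k : ℕ+ × ℕ+) : 1 / 2 ≤ beta k := by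
  have h1 := one_le_natCast_pnat k.1
  have h2 := one_le_natCast_pnat k.2
  unfold beta; nlinarith

theorem beta_pos (k : ℕ+ × ℕ+) : 0 < beta k := by linarith [half_le_beta k]

theorem half_fst_le (k : ℕ+ × ℕ+) : ((k.1 : ℕ) : ℝ) / 2 ≤ (1 + beta k) / 2 := by
  unfold beta; nlinarith [sq_nonneg (((k.1 : ℕ) : ℝ) / 2 - 1), sq_nonneg ((k.2 : ℕ) : ℝ)]

theorem half_snd_le (k : ℕ+ × ℕ+) : ((k.2 : ℕ) : ℝ) / 2 ≤ (1 + beta k) / 2 := by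
  unfold beta; nlinarith [sq_nonneg (((k.2 : ℕ) : ℝ) / 2 - 1), sq_nonneg ((k.1 : ℕ) : ℝ)]

/-- `n² + m² ≥ 2nm` gives `β ≥ nm/2`, which separates the double sum into a product. -/
theorem summable_inv_beta_sq : Summable fun k : ℕ+ × ℕ+ => (1 / beta k) ^ 2 := by
  have h1 : Summable fun n : ℕ+ => 1 / ((n : ℕ) : ℝ) ^ 2 :=
    (Real.summable_one_div_nat_pow.2 one_lt_two).comp_injective PNat.coe_injective
  have h2 := (h1.mul_of_nonneg h1 (fun n => by positivity) (fun n => by positivity)).mul_left 4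
  refine Summable.of_nonneg_of_le (fun k => by positivity) (fun k => ?_) h2
  have hn := one_le_natCast_pnat k.1
  have hm := one_le_natCast_pnat k.2
  have hb : ((k.1 : ℕ) : ℝ) * ((k.2 : ℕ) : ℝ) / 2 ≤ beta k := by
    unfold beta; nlinarith [sq_nonneg (((k.1 : ℕ) : ℝ) - ((k.2 : ℕ) : ℝ))]
  have hb0 := beta_pos k
  calc (1 / beta k) ^ 2 ≤ (1 / (((k.1 : ℕ) : ℝ) * ((k.2 : ℕ) : ℝ) / 2)) ^ 2 := by gcongr
    _ = _ := by field_simp; norm_num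

/-- From `(n/2)² ≤ β`, the fourth power of the weight is at most `1/β²`. That bound is summable, so
it tends to zero, and the fourth root transfers the limit. -/
theorem tendsto_fst_weight :
    Tendsto (fun k : ℕ+ × ℕ+ => ((k.1 : ℕ) : ℝ) / 2 / (1 + beta k)) cofinite (𝓝 0) := by
  have h := summable_inv_beta_sq.tendsto_cofinite_zero
  have h2 : Tendsto (fun k : ℕ+ × ℕ+ => (((k.1 : ℕ) : ℝ) / 2 / (1 + beta k)) ^ 4)
      cofinite (𝓝 0) := by
    refine squeeze_zero (fun k => by positivity) (fun k => ?_) h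
    have hb := beta_pos k
    have h1 : (((k.1 : ℕ) : ℝ) / 2) ^ 2 ≤ beta k := by
      unfold beta; nlinarith [sq_nonneg ((k.2 : ℕ) : ℝ)]
    have h3 : (((k.1 : ℕ) : ℝ) / 2) ^ 4 ≤ beta k ^ 2 := by
      calc (((k.1 : ℕ) : ℝ) / 2) ^ 4 = ((((k.1 : ℕ) : ℝ) / 2) ^ 2) ^ 2 := by ring
        _ ≤ _ := by gcongr
    rw [div_pow, div_pow 1, one_pow, div_le_div_iff₀ (by positivity) (by positivity)]
    calc _ ≤ beta k ^ 2 * beta k ^ 2 := by gcongr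
      _ = beta k ^ 4 := by ring
      _ ≤ 1 * (1 + beta k) ^ 4 := by rw [one_mul]; gcongr; linarith
  have h3 := h2.norm
  rw [tendsto_zero_iff_norm_tendsto_zero]
  have h4 := (Real.continuous_rpow_const (q := 1 / 4) (by norm_num)).tendsto 0 |>.comp
    (by simpa using h3)
  simp only [one_div, ne_eq, inv_eq_zero, OfNat.ofNat_ne_zero, not_false_eq_true,
    Real.zero_rpow] at h4
  refine h4.congr fun k => ?_
  simp only [Function.comp_apply]
  have := Real.pow_rpow_inv_natCast (norm_nonneg (((k.1 : ℕ) : ℝ) / 2 / (1 + beta k)))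
    (n := 4) (by norm_num)
  simpa using this

theorem beta_swap (k : ℕ+ × ℕ+) : beta k.swap = beta k := by
  simp [beta, add_comm]

theorem tendsto_snd_weight :
    Tendsto (fun k : ℕ+ × ℕ+ => ((k.2 : ℕ) : ℝ) / 2 / (1 + beta k)) cofinite (𝓝 0) := by
  refine (tendsto_fst_weight.comp (Prod.swap_injective.tendsto_cofinite)).congr fun k => ?_
  simp [beta_swap]

/-! ### Weighted series of bounded continuous functions -/

theorem summable_mul_of_sq {c : ℕ+ × ℕ+ → ℝ} (hc : Summable fun k => c k ^ 2) (ψ : H4) :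
    Summable fun k => |c k * ψ k| := by
  have h2 : Summable fun k => ψ k ^ 2 := by
    have := (lp.memℓp ψ).summable (by norm_num)
    simpa using this
  refine Summable.of_nonneg_of_le (fun k => abs_nonneg _) (fun k => ?_) (hc.add h2)
  rw [abs_mul]
  nlinarith [sq_nonneg (|c k| - |ψ k|), sq_abs (c k), sq_abs (ψ k), sq_nonneg (c k), sq_nonneg (ψ k)]

/-- Cauchy–Schwarz on finite sums; this is the bound for series with square-summable weights as maps
into bounded continuous functions. -/
theorem tsum_abs_mul_le {c : ℕ+ × ℕ+ → ℝ} (hc : Summable fun k => c k ^ 2) (ψ : H4) :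
    ∑' k, |c k * ψ k| ≤ Real.sqrt (∑' k, c k ^ 2) * ‖ψ‖ := by
  have hψ : ∀ s : Finset (ℕ+ × ℕ+), ∑ k ∈ s, ψ k ^ 2 ≤ ‖ψ‖ ^ 2 := fun s => by
    have := lp.sum_rpow_le_norm_rpow (p := 2) (by norm_num) ψ s
    simpa using this
  refine (summable_mul_of_sq hc ψ).tsum_le_of_sum_le fun s => ?_
  have h1 := Finset.sum_mul_sq_le_sq_mul_sq s (fun k => |c k|) (fun k => |ψ k|)
  simp only [← abs_mul, sq_abs] at h1
  refine abs_le_of_sq_le_sq' (b := Real.sqrt (∑' k, c k ^ 2) * ‖ψ‖) ?_ (by positivity) |>.2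
  rw [mul_pow, Real.sq_sqrt (tsum_nonneg fun k => sq_nonneg _)]
  refine h1.trans ?_
  gcongr
  · exact hc.sum_le_tsum s fun k _ => sq_nonneg _
  · exact hψ s

/-- The map `ψ ↦ ∑ c_k ψ_k e_k`, for square-summable `c` and bounded `e`. -/
noncomputable def series (c : ℕ+ × ℕ+ → ℝ) (hc : Summable fun k => c k ^ 2)
    (e : ℕ+ × ℕ+ → (ℝ × ℝ →ᵇ ℝ)) (he : ∀ k, ‖e k‖ ≤ 1) : H4 →L[ℝ] (ℝ × ℝ →ᵇ ℝ) :=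
  have hs : ∀ ψ : H4, Summable fun k => ‖(c k * ψ k) • e k‖ := fun ψ =>
    Summable.of_nonneg_of_le (fun k => norm_nonneg _)
      (fun k => by
        rw [norm_smul]
        exact mul_le_of_le_one_right (norm_nonneg _) (he k)) (summable_mul_of_sq hc ψ)
  LinearMap.mkContinuous
    { toFun := fun ψ => ∑' k, (c k * ψ k) • e k
      map_add' := fun ψ φ => by
        rw [← (hs ψ).of_norm.tsum_add (hs φ).of_norm]
        refine tsum_congr fun k => ?_
        simp [mul_add, add_smul]
      map_smul' := fun r ψ => by
        simp only [RingHom.id_apply]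
        rw [← (hs ψ).of_norm.tsum_const_smul r]
        refine tsum_congr fun k => ?_
        simp only [lp.coeFn_smul, Pi.smul_apply, smul_smul, smul_eq_mul]
        congr 1
        ring }
    (Real.sqrt (∑' k, c k ^ 2)) fun ψ => by
      refine le_trans ?_ (tsum_abs_mul_le hc ψ)
      refine (norm_tsum_le_tsum_norm (hs ψ)).trans ?_
      refine (hs ψ).tsum_le_tsum (fun k => ?_) (summable_mul_of_sq hc ψ)
      rw [norm_smul]
      exact mul_le_of_le_one_right (norm_nonneg _) (he k)

theorem hasSum_series (c : ℕ+ × ℕ+ → ℝ) (hc : Summable fun k => c k ^ 2)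
    (e : ℕ+ × ℕ+ → (ℝ × ℝ →ᵇ ℝ)) (he : ∀ k, ‖e k‖ ≤ 1) (ψ : H4) :
    HasSum (fun k => (c k * ψ k) • e k) (series c hc e he ψ) := by
  have hs : Summable fun k => ‖(c k * ψ k) • e k‖ :=
    Summable.of_nonneg_of_le (fun k => norm_nonneg _)
      (fun k => by
        rw [norm_smul]
        exact mul_le_of_le_one_right (norm_nonneg _) (he k)) (summable_mul_of_sq hc ψ)
  exact hs.of_norm.hasSum

theorem series_single (c : ℕ+ × ℕ+ → ℝ) (hc : Summable fun k => c k ^ 2)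
    (e : ℕ+ × ℕ+ → (ℝ × ℝ →ᵇ ℝ)) (he : ∀ k, ‖e k‖ ≤ 1) (k : ℕ+ × ℕ+) (r : ℝ) :
    series c hc e he (lp.single 2 k r) = (c k * r) • e k := by
  refine (hasSum_series c hc e he _).unique ?_
  convert hasSum_single (α := ℝ × ℝ →ᵇ ℝ) k ?_ using 1
  · simp
  · intro l hl
    simp [hl]

theorem series_apply (c : ℕ+ × ℕ+ → ℝ) (hc : Summable fun k => c k ^ 2)
    (e : ℕ+ × ℕ+ → (ℝ × ℝ →ᵇ ℝ)) (he : ∀ k, ‖e k‖ ≤ 1) (ψ : H4) (p : ℝ × ℝ) :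
    series c hc e he ψ p = ∑' k, c k * ψ k * e k p := by
  have := (hasSum_series c hc e he ψ).map (BoundedContinuousFunction.evalCLM ℝ p)
    (ContinuousLinearMap.continuous _)
  simpa [Function.comp_def] using this.tsum_eq.symm


/-! ### Bifurcation from a simple eigenvalue -/

section Bifurcation

variable {E : Type*} [NormedAddCommGroup E] [NormedSpace ℝ E] [CompleteSpace E]

/-- Fredholm alternative: `-1` is an eigenvalue of the compact operator or lies in its resolvent
set, and injectivity excludes the first case. -/
theorem exists_equiv_id_add_compact {T : E →L[ℝ] E} (hT : IsCompactOperator T)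
    (hinj : ∀ x, x + T x = 0 → x = 0) : ∃ e : E ≃L[ℝ] E, ∀ x, e x = x + T x := by
  have h := hT.hasEigenvalue_or_mem_resolventSet (μ := (-1 : ℝ)) (by norm_num)
  have h2 : (-1 : ℝ) ∈ resolventSet ℝ T := by
    refine h.resolve_left fun hev => ?_
    obtain ⟨x, hx⟩ := hev.exists_hasEigenvector
    refine hx.2 (hinj x ?_)
    have := hx.apply_eq_smul
    simp only [ContinuousLinearMap.coe_coe] at this
    rw [this]; simp
  have h3 : IsUnit (1 + T) := by
    have h4 := (spectrum.mem_resolventSet_iff.1 h2).neg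
    convert h4 using 1
    simp [add_comm]
  obtain ⟨u, hu⟩ := h3
  refine ⟨ContinuousLinearEquiv.unitsEquiv ℝ E u, fun x => ?_⟩
  simp [hu]

/-- The branch of nontrivial solutions of `(1 + κ) φ + C φ + ε M (φ, φ) = 0`, `φ = ψ + Ψ`,
`ℓ Ψ = 0`, through `ε = 0`, `κ = 0`, `Ψ = 0`. -/
theorem exists_bifurcation_branch {C : E →L[ℝ] E} (hC : IsCompactOperator C)
    (M : E →L[ℝ] E →L[ℝ] E) (ψ : E) (ℓ : E →L[ℝ] ℝ) (hψ : ψ + C ψ = 0)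
    (hinj : ∀ (Ψ : E) (κ : ℝ), Ψ + C Ψ + κ • ψ = 0 → ℓ Ψ = 0 → Ψ = 0 ∧ κ = 0) :
    ∃ (a : ℝ) (κ : ℝ → ℝ) (Ψ : ℝ → E), 0 < a ∧
      ContinuousOn κ (Ioo (-a) a) ∧ ContinuousOn Ψ (Ioo (-a) a) ∧ κ 0 = 0 ∧ Ψ 0 = 0 ∧
      ∀ ε ∈ Ioo (-a) a, ℓ (Ψ ε) = 0 ∧ 0 < 1 + κ ε ∧
        (1 + κ ε) • (ψ + Ψ ε) + C (ψ + Ψ ε) + ε • M (ψ + Ψ ε) (ψ + Ψ ε) = 0 := by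
  -- the compact perturbation of the identity given by the linearisation in `(Ψ, κ)`
  let T : E × ℝ →L[ℝ] E × ℝ :=
    ContinuousLinearMap.prod
      (C.comp (ContinuousLinearMap.fst ℝ E ℝ) +
        (ContinuousLinearMap.toSpanSingleton ℝ ψ).comp (ContinuousLinearMap.snd ℝ E ℝ))
      -- The term `-κ` cancels the identity in the second slot, so that `1 + T` has second component
      -- `ℓ Ψ`.
      (ℓ.comp (ContinuousLinearMap.fst ℝ E ℝ) - ContinuousLinearMap.snd ℝ E ℝ)
  have hTa : ∀ x, T x = (C x.1 + x.2 • ψ, ℓ x.1 - x.2) := fun x => by simp [T]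
  have hT : IsCompactOperator T := by
    have e1 : IsCompactOperator ((ContinuousLinearMap.inl ℝ E ℝ).comp
        (C.comp (ContinuousLinearMap.fst ℝ E ℝ))) :=
      (hC.comp_clm (ContinuousLinearMap.fst ℝ E ℝ)).clm_comp (ContinuousLinearMap.inl ℝ E ℝ)
    have hid : IsCompactOperator (id : ℝ → ℝ) :=
      isCompactOperator_id_iff_locallyCompactSpace.2 inferInstance
    have e2 : IsCompactOperator (((ContinuousLinearMap.inl ℝ E ℝ).comp
        (ContinuousLinearMap.toSpanSingleton ℝ ψ)).comp (ContinuousLinearMap.snd ℝ E ℝ)) :=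
      (hid.comp_clm (ContinuousLinearMap.snd ℝ E ℝ)).clm_comp
        ((ContinuousLinearMap.inl ℝ E ℝ).comp (ContinuousLinearMap.toSpanSingleton ℝ ψ))
    have e3 : IsCompactOperator ((ContinuousLinearMap.inr ℝ E ℝ).comp
        (ℓ.comp (ContinuousLinearMap.fst ℝ E ℝ) - ContinuousLinearMap.snd ℝ E ℝ)) :=
      (hid.comp_clm (ℓ.comp (ContinuousLinearMap.fst ℝ E ℝ) -
        ContinuousLinearMap.snd ℝ E ℝ)).clm_comp (ContinuousLinearMap.inr ℝ E ℝ)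
    have hsum : ⇑T = (⇑((ContinuousLinearMap.inl ℝ E ℝ).comp
        (C.comp (ContinuousLinearMap.fst ℝ E ℝ))) + ⇑(((ContinuousLinearMap.inl ℝ E ℝ).comp
        (ContinuousLinearMap.toSpanSingleton ℝ ψ)).comp (ContinuousLinearMap.snd ℝ E ℝ))) +
        ⇑((ContinuousLinearMap.inr ℝ E ℝ).comp
        (ℓ.comp (ContinuousLinearMap.fst ℝ E ℝ) - ContinuousLinearMap.snd ℝ E ℝ)) := by
      funext x
      rw [hTa]
      ext <;> simp
    rw [hsum]
    exact (e1.add e2).add e3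
  obtain ⟨e, he⟩ := exists_equiv_id_add_compact hT (by
    rintro ⟨Ψ, κ⟩ h
    rw [hTa] at h
    simp only [Prod.mk_add_mk, Prod.mk_eq_zero] at h
    have := hinj Ψ κ (by rw [add_assoc]; exact h.1) (by linarith [h.2])
    simp [this.1, this.2])
  -- the inverse function theorem for `(ε, x) ↦ (ε, G (ε, x))`
  let G : ℝ × E × ℝ → E × ℝ := fun y =>
    ((1 + y.2.2) • (ψ + y.2.1) + C (ψ + y.2.1) + y.1 • M (ψ + y.2.1) (ψ + y.2.1), ℓ y.2.1)
  let F : ℝ × E × ℝ → ℝ × E × ℝ := fun y => (y.1, G y)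
  have hF : ContDiff ℝ 1 F := by
    have h1 : ContDiff ℝ 1 fun y : ℝ × E × ℝ => M (ψ + y.2.1) (ψ + y.2.1) :=
      ContDiff.clm_apply (M.contDiff.comp (by fun_prop)) (by fun_prop)
    have h2 : ContDiff ℝ 1 fun y : ℝ × E × ℝ => C (ψ + y.2.1) := C.contDiff.comp (by fun_prop)
    have h3 : ContDiff ℝ 1 fun y : ℝ × E × ℝ => ℓ y.2.1 := ℓ.contDiff.comp (by fun_prop)
    exact contDiff_fst.prodMk
      ((((by fun_prop : ContDiff ℝ 1 fun y : ℝ × E × ℝ => (1 + y.2.2) • (ψ + y.2.1)).add h2).add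
        (contDiff_fst.smul h1)).prodMk h3)
  -- The derivative of `F` is block triangular: identity on `ε`, the isomorphism `e` on `(Ψ, κ)`,
  -- and the column `M ψ ψ` below the diagonal.
  let L : (ℝ × E × ℝ) ≃L[ℝ] (ℝ × E × ℝ) :=
    (ContinuousLinearEquiv.refl ℝ ℝ).skewProd e
      (ContinuousLinearMap.toSpanSingleton ℝ ((M ψ ψ, 0) : E × ℝ))
  have hLa : ∀ y, L y = (y.1, (y.2.1 + C y.2.1 + y.2.2 • ψ + y.1 • M ψ ψ, ℓ y.2.1)) := fun y => by
    simp only [L, ContinuousLinearEquiv.skewProd_apply, he, hTa]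
    ext <;> simp [add_assoc]
  have hF' : HasFDerivAt F (L : (ℝ × E × ℝ) →L[ℝ] (ℝ × E × ℝ)) 0 := by
    have hd : DifferentiableAt ℝ F 0 := hF.differentiable (by norm_num) 0
    have : fderiv ℝ F 0 = L := by
      refine ContinuousLinearMap.ext fun y => ?_
      rw [← hd.lineDeriv_eq_fderiv]
      have hline : HasLineDerivAt ℝ F (L y) 0 y := by
        unfold HasLineDerivAt
        -- Along a line through the origin `F` is a cubic polynomial in `t` whose constant term
        -- vanishes by `hψ`. Its linear coefficient is the directional derivative.
        have hpoly : (fun t : ℝ => F (0 + t • y)) = fun t : ℝ =>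
            (t • L y + (t ^ 2) • ((0 : ℝ), ((y.2.2 • y.2.1 + y.1 • (M ψ y.2.1 + M y.2.1 ψ)), (0 : ℝ)))
              + (t ^ 3) • ((0 : ℝ), (y.1 • M y.2.1 y.2.1, (0 : ℝ))) : ℝ × E × ℝ) := by
          funext t
          have hC' : C ψ = -ψ := by rw [eq_neg_iff_add_eq_zero, add_comm]; exact hψ
          simp only [F, G, hLa, zero_add, Prod.smul_fst, Prod.smul_snd, map_add, map_smul,
            _root_.add_apply, _root_.smul_apply, hC']
          ext
          · simp
          · simp only [smul_eq_mul, Prod.fst_add, Prod.snd_add, Prod.smul_fst, Prod.smul_snd]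
            module
          · simp
        rw [hpoly]
        have h1 := ((hasDerivAt_id (0 : ℝ)).smul_const (L y))
        have h2 := ((hasDerivAt_pow 2 (0 : ℝ)).smul_const
          (((0 : ℝ), ((y.2.2 • y.2.1 + y.1 • (M ψ y.2.1 + M y.2.1 ψ)), (0 : ℝ))) : ℝ × E × ℝ))
        have h3 := ((hasDerivAt_pow 3 (0 : ℝ)).smul_const
          (((0 : ℝ), (y.1 • M y.2.1 y.2.1, (0 : ℝ))) : ℝ × E × ℝ))
        have h4 := (h1.add h2).add h3
        simpa using! h4
      exact hline.lineDeriv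
    rw [← this]
    exact hd.hasFDerivAt
  have hst : HasStrictFDerivAt F (L : (ℝ × E × ℝ) →L[ℝ] (ℝ × E × ℝ)) 0 :=
    hF.contDiffAt.hasStrictFDerivAt' hF' (by norm_num)
  have hF0 : F 0 = 0 := by
    have : ψ + C ψ = 0 := hψ
    simp [F, G, this]
  let Θ := hst.toOpenPartialHomeomorph F
  have hΘ : ∀ y, Θ y = F y := fun y => rfl
  have h0s : (0 : ℝ × E × ℝ) ∈ Θ.source := hst.mem_toOpenPartialHomeomorph_source
  have h0t : (0 : ℝ × E × ℝ) ∈ Θ.target := by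
    have := hst.image_mem_toOpenPartialHomeomorph_target
    rwa [hF0] at this
  have hsymm0 : Θ.symm 0 = 0 := by
    have := Θ.left_inv h0s
    rwa [hΘ, hF0] at this
  let ι : ℝ → ℝ × E × ℝ := fun ε => (ε, 0)
  have hι : Continuous ι := by fun_prop
  -- Shrinking to `1 + κ > 0` allows later division by `1 + κ`.
  let W : Set (ℝ × E × ℝ) := Θ.target ∩ Θ.symm ⁻¹' {y | 0 < 1 + y.2.2}
  have hW : IsOpen W := Θ.isOpen_inter_preimage_symm
    (isOpen_lt (by fun_prop) (by fun_prop))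
  have h0W : ι 0 ∈ W := by
    have : ι 0 = 0 := rfl
    rw [this]
    exact ⟨h0t, by simp [hsymm0]⟩
  obtain ⟨a, ha, haW⟩ := Metric.isOpen_iff.1 (hW.preimage hι) 0 h0W
  have hball : ∀ ε ∈ Ioo (-a) a, ι ε ∈ W := fun ε hε => by
    refine haW ?_
    rw [Real.ball_eq_Ioo]
    simpa using hε
  have hcont : ContinuousOn (fun ε => Θ.symm (ι ε)) (Ioo (-a) a) :=
    Θ.continuousOn_symm.comp hι.continuousOn fun ε hε => (hball ε hε).1
  refine ⟨a, fun ε => (Θ.symm (ι ε)).2.2, fun ε => (Θ.symm (ι ε)).2.1, ha,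
    continuous_snd.comp_continuousOn (continuous_snd.comp_continuousOn hcont),
    continuous_fst.comp_continuousOn (continuous_snd.comp_continuousOn hcont),
    ?_, ?_, fun ε hε => ?_⟩
  · change (Θ.symm 0).2.2 = 0
    rw [hsymm0]; rfl
  · change (Θ.symm 0).2.1 = 0
    rw [hsymm0]; rfl
  · have h1 := Θ.right_inv (hball ε hε).1
    rw [hΘ] at h1
    have h2 : (Θ.symm (ι ε)).1 = ε := congrArg Prod.fst h1
    have h3 : G (Θ.symm (ι ε)) = 0 := congrArg Prod.snd h1
    have h4 := congrArg Prod.fst h3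
    have h5 := congrArg Prod.snd h3
    simp only [G, h2] at h4 h5
    exact ⟨h5, (hball ε hε).2, h4⟩

end Bifurcation

/-! ### Integrals of products of half-integer sines and cosines -/

/-- `sin (j x / 2)`. -/
noncomputable def sn (j : ℤ) (x : ℝ) : ℝ := Real.sin (j * x / 2)

/-- `cos (j x / 2)`. -/
noncomputable def cn (j : ℤ) (x : ℝ) : ℝ := Real.cos (j * x / 2)

@[fun_prop]
theorem continuous_sn (j : ℤ) : Continuous (sn j) := by unfold sn; fun_prop

@[fun_prop]
theorem continuous_cn (j : ℤ) : Continuous (cn j) := by unfold cn; fun_prop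

theorem hasDerivAt_sn (j : ℤ) (x : ℝ) : HasDerivAt (sn j) (j / 2 * cn j x) x := by
  have h1 : HasDerivAt (fun x : ℝ => (j : ℝ) * x / 2) (j / 2) x := by
    simpa using ((hasDerivAt_id x).const_mul (j : ℝ)).div_const 2
  have := h1.sin
  rw [mul_comm] at this
  exact this

theorem hasDerivAt_cn (j : ℤ) (x : ℝ) : HasDerivAt (cn j) (-(j / 2 * sn j x)) x := by
  have h1 : HasDerivAt (fun x : ℝ => (j : ℝ) * x / 2) (j / 2) x := by
    simpa using ((hasDerivAt_id x).const_mul (j : ℝ)).div_const 2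
  have := h1.cos
  refine this.congr_deriv ?_
  unfold sn; ring

theorem abs_sn_le (j : ℤ) (x : ℝ) : |sn j x| ≤ 1 := Real.abs_sin_le_one _

theorem abs_cn_le (j : ℤ) (x : ℝ) : |cn j x| ≤ 1 := Real.abs_cos_le_one _

theorem sn_zero_left (x : ℝ) : sn 0 x = 0 := by simp [sn]

theorem sn_neg (j : ℤ) (x : ℝ) : sn (-j) x = -sn j x := by
  simp only [sn]; push_cast
  rw [← Real.sin_neg]; congr 1; ring

theorem cn_mul_sn (i j : ℤ) (x : ℝ) : cn i x * sn j x = (sn (i + j) x + sn (j - i) x) / 2 := by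
  simp only [sn, cn]
  push_cast
  rw [show ((i : ℝ) + j) * x / 2 = i * x / 2 + j * x / 2 by ring,
    show ((j : ℝ) - i) * x / 2 = j * x / 2 - i * x / 2 by ring, Real.sin_add, Real.sin_sub]
  ring

/-- The integral over `(0, 2π)`. -/
noncomputable def perInt (f : ℝ → ℝ) : ℝ := ∫ x in Ioo 0 (2 * Real.pi), f x

theorem perInt_eq (f : ℝ → ℝ) : perInt f = ∫ x in (0 : ℝ)..(2 * Real.pi), f x := by
  rw [perInt, intervalIntegral.integral_of_le (by positivity), integral_Ioc_eq_integral_Ioo]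

theorem perInt_eq_zero_of_reflect {f : ℝ → ℝ} (h : ∀ x, f (2 * Real.pi - x) = -f x) :
    perInt f = 0 := by
  have h1 := intervalIntegral.integral_comp_sub_left (a := 0) (b := 2 * Real.pi) f (2 * Real.pi)
  simp only [h, intervalIntegral.integral_neg, sub_self, sub_zero] at h1
  rw [perInt_eq]; linarith

theorem perInt_eq_zero_of_shift {f : ℝ → ℝ} (hf : Continuous f)
    (h : ∀ x, f (x + Real.pi) = -f x) : perInt f = 0 := by
  have h1 := intervalIntegral.integral_comp_add_right (a := 0) (b := Real.pi) f Real.pi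
  simp only [h, intervalIntegral.integral_neg, zero_add] at h1
  have h2 := intervalIntegral.integral_add_adjacent_intervals (μ := volume)
    (hf.intervalIntegrable 0 Real.pi) (hf.intervalIntegrable Real.pi (Real.pi + Real.pi))
  rw [perInt_eq, two_mul, ← h2, ← h1]; ring

theorem perInt_deriv_eq_zero {f f' : ℝ → ℝ} (h : ∀ x, HasDerivAt f (f' x) x)
    (hc : Continuous f') (h0 : f (2 * Real.pi) = f 0) : perInt f' = 0 := by
  rw [perInt_eq, intervalIntegral.integral_eq_sub_of_hasDerivAt (fun x _ => h x)
    (hc.intervalIntegrable _ _), h0, sub_self]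

theorem perInt_cn (j : ℤ) : perInt (cn j) = if j = 0 then 2 * Real.pi else 0 := by
  split_ifs with h
  · subst h
    simp [perInt_eq, cn]
  · have hj : (j : ℝ) ≠ 0 := by exact_mod_cast h
    refine perInt_deriv_eq_zero (f := fun x => 2 / j * sn j x) (fun x => ?_) (by fun_prop) ?_
    · refine ((hasDerivAt_sn j x).const_mul (2 / (j : ℝ))).congr_deriv ?_
      field_simp
    · have : sn j (2 * Real.pi) = 0 := by
        rw [sn, show (j : ℝ) * (2 * Real.pi) / 2 = j * Real.pi by ring]
        exact Real.sin_int_mul_pi j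
      have h0 : sn j 0 = 0 := by simp [sn]
      rw [this, h0]

theorem perInt_add {f g : ℝ → ℝ} (hf : Continuous f) (hg : Continuous g) :
    perInt (fun x => f x + g x) = perInt f + perInt g := by
  simp only [perInt_eq]
  exact intervalIntegral.integral_add (hf.intervalIntegrable _ _) (hg.intervalIntegrable _ _)

theorem perInt_const_mul (c : ℝ) (f : ℝ → ℝ) : perInt (fun x => c * f x) = c * perInt f := by
  simp only [perInt_eq]
  exact intervalIntegral.integral_const_mul _ _

theorem perInt_sn_mul_sn (n m : ℕ+) :
    perInt (fun x => sn (n : ℕ) x * sn (m : ℕ) x) = if n = m then Real.pi else 0 := by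
  have h : ∀ x, sn (n : ℕ) x * sn (m : ℕ) x =
      1 / 2 * cn ((n : ℕ) - (m : ℕ)) x + (-1 / 2) * cn ((n : ℕ) + (m : ℕ)) x := fun x => by
    simp only [sn, cn]
    push_cast
    rw [show (((n : ℕ) : ℝ) + (m : ℕ)) * x / 2 = (n : ℕ) * x / 2 + (m : ℕ) * x / 2 by ring,
      show (((n : ℕ) : ℝ) - (m : ℕ)) * x / 2 = (n : ℕ) * x / 2 - (m : ℕ) * x / 2 by ring,
      Real.cos_add, Real.cos_sub]
    ring
  simp only [h]
  rw [perInt_add (by fun_prop) (by fun_prop), perInt_const_mul, perInt_const_mul, perInt_cn,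
    perInt_cn]
  have hn := n.pos
  have h1 : ¬ (((n : ℕ) : ℤ) + ((m : ℕ) : ℤ) = 0) := by omega
  have h2 : (((n : ℕ) : ℤ) - ((m : ℕ) : ℤ) = 0) ↔ n = m := by
    rw [← PNat.coe_inj]; omega
  simp only [h1, h2, if_false]
  split_ifs <;> ring

theorem perInt_cn_mul_cn (n m : ℕ+) :
    perInt (fun x => cn (n : ℕ) x * cn (m : ℕ) x) = if n = m then Real.pi else 0 := by
  have h : ∀ x, cn (n : ℕ) x * cn (m : ℕ) x =
      1 / 2 * cn ((n : ℕ) - (m : ℕ)) x + (1 / 2) * cn ((n : ℕ) + (m : ℕ)) x := fun x => by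
    simp only [cn]
    push_cast
    rw [show (((n : ℕ) : ℝ) + (m : ℕ)) * x / 2 = (n : ℕ) * x / 2 + (m : ℕ) * x / 2 by ring,
      show (((n : ℕ) : ℝ) - (m : ℕ)) * x / 2 = (n : ℕ) * x / 2 - (m : ℕ) * x / 2 by ring,
      Real.cos_add, Real.cos_sub]
    ring
  simp only [h]
  rw [perInt_add (by fun_prop) (by fun_prop), perInt_const_mul, perInt_const_mul, perInt_cn,
    perInt_cn]
  have hn := n.pos
  have h1 : ¬ (((n : ℕ) : ℤ) + ((m : ℕ) : ℤ) = 0) := by omega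
  have h2 : (((n : ℕ) : ℤ) - ((m : ℕ) : ℤ) = 0) ↔ n = m := by
    rw [← PNat.coe_inj]; omega
  simp only [h1, h2, if_false]
  split_ifs <;> ring

theorem sn_two_pi_sub (j : ℤ) (x : ℝ) : sn j (2 * Real.pi - x) = -((-1) ^ j * sn j x) := by
  rw [sn, show (j : ℝ) * (2 * Real.pi - x) / 2 = j * Real.pi - j * x / 2 by ring,
    Real.sin_int_mul_pi_sub, sn]

theorem cn_two_pi_sub (j : ℤ) (x : ℝ) : cn j (2 * Real.pi - x) = (-1) ^ j * cn j x := by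
  rw [cn, show (j : ℝ) * (2 * Real.pi - x) / 2 = j * Real.pi - j * x / 2 by ring,
    Real.cos_int_mul_pi_sub, cn]

/-- Under `x ↦ 2π - x` the minus signs of the two sines cancel, and the integrand is multiplied by
`(-1)^(a+b+c) = -1`. -/
theorem perInt_cn_sn_sn_eq_zero {a b c : ℤ} (h : Odd (a + b + c)) :
    perInt (fun x => cn a x * sn b x * sn c x) = 0 := by
  refine perInt_eq_zero_of_reflect fun x => ?_
  rw [cn_two_pi_sub, sn_two_pi_sub, sn_two_pi_sub]
  have : (-1 : ℝ) ^ a * (-1) ^ b * (-1) ^ c = -1 := by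
    rw [← zpow_add₀ (by norm_num), ← zpow_add₀ (by norm_num)]
    exact h.neg_one_zpow
  linear_combination (cn a x * sn b x * sn c x) * this

theorem sn_two_mul_add_pi (j : ℤ) (x : ℝ) : sn (2 * j) (x + Real.pi) = (-1) ^ j * sn (2 * j) x := by
  rw [sn, sn]; push_cast
  rw [show (2 * (j : ℝ)) * (x + Real.pi) / 2 = (2 * j) * x / 2 + j * Real.pi by ring,
    Real.sin_add_int_mul_pi]

theorem cn_two_mul_add_pi (j : ℤ) (x : ℝ) : cn (2 * j) (x + Real.pi) = (-1) ^ j * cn (2 * j) x := by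
  rw [cn, cn]; push_cast
  rw [show (2 * (j : ℝ)) * (x + Real.pi) / 2 = (2 * j) * x / 2 + j * Real.pi by ring,
    Real.cos_add_int_mul_pi]

/-- Even frequencies become integer ones, and translation by `π` multiplies the integrand by
`(-1)^(a+b+c) = -1`. -/
theorem perInt_even_eq_zero {a b c : ℤ} (h : Odd (a + b + c)) :
    perInt (fun x => cn (2 * a) x * sn (2 * b) x * sn (2 * c) x) = 0 := by
  refine perInt_eq_zero_of_shift (by fun_prop) fun x => ?_
  rw [cn_two_mul_add_pi, sn_two_mul_add_pi, sn_two_mul_add_pi]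
  have : (-1 : ℝ) ^ a * (-1) ^ b * (-1) ^ c = -1 := by
    rw [← zpow_add₀ (by norm_num), ← zpow_add₀ (by norm_num)]
    exact h.neg_one_zpow
  linear_combination (cn (2 * a) x * sn (2 * b) x * sn (2 * c) x) * this

/-- The sum is the integral of the derivative of a triple product of sines, which vanishes at both
endpoints. -/
theorem perInt_leibniz (a b c : ℤ) :
    (a : ℝ) / 2 * perInt (fun x => cn a x * sn b x * sn c x) +
      (b : ℝ) / 2 * perInt (fun x => cn b x * sn a x * sn c x) +
      (c : ℝ) / 2 * perInt (fun x => cn c x * sn a x * sn b x) = 0 := by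
  rw [← perInt_const_mul, ← perInt_const_mul, ← perInt_const_mul,
    ← perInt_add (by fun_prop) (by fun_prop), ← perInt_add (by fun_prop) (by fun_prop)]
  refine perInt_deriv_eq_zero (f := fun x => sn a x * sn b x * sn c x) (fun x => ?_)
    (by fun_prop) ?_
  · refine (((hasDerivAt_sn a x).mul (hasDerivAt_sn b x)).mul (hasDerivAt_sn c x)).congr_deriv ?_
    simp only [Pi.mul_apply]
    ring
  · have : sn a (2 * Real.pi) = 0 := by
      rw [sn, show (a : ℝ) * (2 * Real.pi) / 2 = a * Real.pi by ring]
      exact Real.sin_int_mul_pi a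
    have h0 : sn a 0 = 0 := by simp [sn]
    simp [this, h0]

/-! ### Trigonometric modes in `L²(Ω)` -/

instance : IsFiniteMeasure (volume.restrict Ω) := by
  refine ⟨?_⟩
  rw [Measure.restrict_apply_univ, Ω, Measure.volume_eq_prod, Measure.prod_prod]
  exact ENNReal.mul_lt_top measure_Ioo_lt_top measure_Ioo_lt_top

/-- The Hilbert space `L²(Ω)`. -/
abbrev L2Ω : Type := Lp ℝ 2 (volume.restrict Ω)

/-- The product `f(x) g(y)` as a bounded continuous function. -/
noncomputable def tensor (f g : ℝ → ℝ) (hf : Continuous f) (hg : Continuous g)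
    (hf1 : ∀ x, |f x| ≤ 1) (hg1 : ∀ x, |g x| ≤ 1) : ℝ × ℝ →ᵇ ℝ :=
  BoundedContinuousFunction.ofNormedAddCommGroup (fun p => f p.1 * g p.2) (by fun_prop) 1
    fun p => by
      rw [Real.norm_eq_abs, abs_mul]
      exact mul_le_one₀ (hf1 _) (abs_nonneg _) (hg1 _)

/-- `sin (i x / 2) sin (j y / 2)`. -/
noncomputable def ssB (i j : ℤ) : ℝ × ℝ →ᵇ ℝ :=
  tensor (sn i) (sn j) (by fun_prop) (by fun_prop) (abs_sn_le i) (abs_sn_le j)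

/-- `cos (i x / 2) sin (j y / 2)`. -/
noncomputable def csB (i j : ℤ) : ℝ × ℝ →ᵇ ℝ :=
  tensor (cn i) (sn j) (by fun_prop) (by fun_prop) (abs_cn_le i) (abs_sn_le j)

/-- `sin (i x / 2) cos (j y / 2)`. -/
noncomputable def scB (i j : ℤ) : ℝ × ℝ →ᵇ ℝ :=
  tensor (sn i) (cn j) (by fun_prop) (by fun_prop) (abs_sn_le i) (abs_cn_le j)

theorem ssB_apply (i j : ℤ) (p : ℝ × ℝ) : ssB i j p = sn i p.1 * sn j p.2 := rfl

theorem csB_apply (i j : ℤ) (p : ℝ × ℝ) : csB i j p = cn i p.1 * sn j p.2 := rfl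

theorem scB_apply (i j : ℤ) (p : ℝ × ℝ) : scB i j p = sn i p.1 * cn j p.2 := rfl

/-- The modes `sin (n x / 2) sin (m y / 2)`. -/
noncomputable def ssM (k : ℕ+ × ℕ+) : ℝ × ℝ →ᵇ ℝ := ssB (k.1 : ℕ) (k.2 : ℕ)

/-- The modes `cos (n x / 2) sin (m y / 2)`. -/
noncomputable def csM (k : ℕ+ × ℕ+) : ℝ × ℝ →ᵇ ℝ := csB (k.1 : ℕ) (k.2 : ℕ)

/-- The modes `sin (n x / 2) cos (m y / 2)`. -/
noncomputable def scM (k : ℕ+ × ℕ+) : ℝ × ℝ →ᵇ ℝ := scB (k.1 : ℕ) (k.2 : ℕ)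

theorem ssM_apply (k : ℕ+ × ℕ+) (p : ℝ × ℝ) : ssM k p = mode k p := by
  simp [ssM, ssB_apply, mode, sn]

theorem norm_le_one_of_eq_mul {F : ℝ × ℝ →ᵇ ℝ} {f g : ℝ → ℝ} (h : ∀ p, F p = f p.1 * g p.2)
    (hf : ∀ x, |f x| ≤ 1) (hg : ∀ x, |g x| ≤ 1) : ‖F‖ ≤ 1 :=
  (BoundedContinuousFunction.norm_le zero_le_one).2 fun p => by
    rw [h, Real.norm_eq_abs, abs_mul]
    exact mul_le_one₀ (hf _) (abs_nonneg _) (hg _)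

theorem norm_ssM_le (k : ℕ+ × ℕ+) : ‖ssM k‖ ≤ 1 :=
  norm_le_one_of_eq_mul (ssB_apply _ _) (abs_sn_le _) (abs_sn_le _)

theorem norm_csM_le (k : ℕ+ × ℕ+) : ‖csM k‖ ≤ 1 :=
  norm_le_one_of_eq_mul (csB_apply _ _) (abs_cn_le _) (abs_sn_le _)

theorem norm_scM_le (k : ℕ+ × ℕ+) : ‖scM k‖ ≤ 1 :=
  norm_le_one_of_eq_mul (scB_apply _ _) (abs_sn_le _) (abs_cn_le _)

/-- The class in `L²(Ω)` of a bounded continuous function. -/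
noncomputable def toL2 : (ℝ × ℝ →ᵇ ℝ) →L[ℝ] L2Ω :=
  BoundedContinuousFunction.toLp 2 (volume.restrict Ω) ℝ

theorem coeFn_toL2 (f : ℝ × ℝ →ᵇ ℝ) : toL2 f =ᵐ[volume.restrict Ω] f :=
  BoundedContinuousFunction.coeFn_toLp 2 _ ℝ f

theorem inner_toL2 (f g : ℝ × ℝ →ᵇ ℝ) : ⟪toL2 f, toL2 g⟫ = ∫ p in Ω, f p * g p := by
  rw [toL2, BoundedContinuousFunction.inner_toLp]
  simp [mul_comm]

theorem integral_tensor (f g : ℝ → ℝ) :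
    ∫ p in Ω, f p.1 * g p.2 = perInt f * perInt g := by
  rw [Ω, Measure.volume_eq_prod, setIntegral_prod_mul]; rfl

/-- Multiplication of an `L²` function by a bounded continuous function. -/
noncomputable def mulL : (ℝ × ℝ →ᵇ ℝ) →L[ℝ] L2Ω →L[ℝ] L2Ω :=
  ((ContinuousLinearMap.mul ℝ ℝ).holderL (volume.restrict Ω) ⊤ 2 2).comp
    (BoundedContinuousFunction.toLp ⊤ (volume.restrict Ω) ℝ)

theorem coeFn_mulL (f : ℝ × ℝ →ᵇ ℝ) (g : L2Ω) :
    mulL f g =ᵐ[volume.restrict Ω] fun p => f p * g p := by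
  have h1 := (ContinuousLinearMap.mul ℝ ℝ).coeFn_holder (r := 2)
    (BoundedContinuousFunction.toLp ⊤ (volume.restrict Ω) ℝ f) g
  have h2 := BoundedContinuousFunction.coeFn_toLp ⊤ (volume.restrict Ω) ℝ f
  have h3 : mulL f g = (ContinuousLinearMap.mul ℝ ℝ).holder 2
    (BoundedContinuousFunction.toLp ⊤ (volume.restrict Ω) ℝ f) g := rfl
  rw [h3]
  filter_upwards [h1, h2] with p hp1 hp2
  rw [hp1, hp2]; rfl

theorem mulL_toL2 (f g : ℝ × ℝ →ᵇ ℝ) : mulL f (toL2 g) = toL2 (f * g) := by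
  refine Lp.ext ?_
  filter_upwards [coeFn_mulL f (toL2 g), coeFn_toL2 g, coeFn_toL2 (f * g)] with p h1 h2 h3
  rw [h1, h2, h3]; rfl

/-- The families of modes normalised by `1 / π` are orthonormal. -/
def IsModeFamily (e : ℕ+ × ℕ+ → (ℝ × ℝ →ᵇ ℝ)) : Prop :=
  Orthonormal ℝ fun k => (1 / Real.pi) • toL2 (e k)

theorem isModeFamily_of_perInt {e : ℕ+ × ℕ+ → (ℝ × ℝ →ᵇ ℝ)} (f g : ℕ+ → ℝ → ℝ)
    (he : ∀ k p, e k p = f k.1 p.1 * g k.2 p.2)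
    (hf : ∀ n m, perInt (fun x => f n x * f m x) = if n = m then Real.pi else 0)
    (hg : ∀ n m, perInt (fun x => g n x * g m x) = if n = m then Real.pi else 0) :
    IsModeFamily e := by
  rw [IsModeFamily, orthonormal_iff_ite]
  intro k l
  rw [inner_smul_left, inner_smul_right, inner_toL2]
  have : ∀ p : ℝ × ℝ, e k p * e l p = (f k.1 p.1 * f l.1 p.1) * (g k.2 p.2 * g l.2 p.2) :=
    fun p => by rw [he, he]; ring
  simp only [this]
  rw [integral_tensor (fun x => f k.1 x * f l.1 x) (fun y => g k.2 y * g l.2 y), hf, hg]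
  have hpi := Real.pi_ne_zero
  by_cases h1 : k.1 = l.1 <;> by_cases h2 : k.2 = l.2 <;>
    simp [h1, h2, Prod.ext_iff, hpi]

theorem isModeFamily_ssM : IsModeFamily ssM :=
  isModeFamily_of_perInt (fun n => sn (n : ℕ)) (fun n => sn (n : ℕ)) (fun _ _ => rfl)
    perInt_sn_mul_sn perInt_sn_mul_sn

theorem isModeFamily_csM : IsModeFamily csM :=
  isModeFamily_of_perInt (fun n => cn (n : ℕ)) (fun n => sn (n : ℕ)) (fun _ _ => rfl)
    perInt_cn_mul_cn perInt_sn_mul_sn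

theorem isModeFamily_scM : IsModeFamily scM :=
  isModeFamily_of_perInt (fun n => sn (n : ℕ)) (fun n => cn (n : ℕ)) (fun _ _ => rfl)
    perInt_sn_mul_sn perInt_cn_mul_cn

section Synthesis

variable {e : ℕ+ × ℕ+ → (ℝ × ℝ →ᵇ ℝ)} (he : IsModeFamily e)

/-- The isometry `c ↦ ∑ c_k e_k / π` with values in `L²(Ω)`. -/
noncomputable def modeIsometry : H4 →ₗᵢ[ℝ] L2Ω := (Orthonormal.orthogonalFamily he).linearIsometry

theorem modeIsometry_single (k : ℕ+ × ℕ+) :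
    modeIsometry he (lp.single 2 k (1 : ℝ)) = (1 / Real.pi) • toL2 (e k) := by
  have := (Orthonormal.orthogonalFamily he).linearIsometry_apply_single (i := k) (1 : ℝ)
  rw [modeIsometry, this]
  simp

/-- The map `c ↦ ∑ c_k e_k` with values in `L²(Ω)`. -/
noncomputable def synth : H4 →L[ℝ] L2Ω :=
  Real.pi • (modeIsometry he).toContinuousLinearMap

/-- The map `f ↦ (⟪e_k, f⟫ / π²)_k`, a left inverse of `synth`. -/
noncomputable def analysis : L2Ω →L[ℝ] H4 :=
  (1 / Real.pi) • ContinuousLinearMap.adjoint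
    (modeIsometry he).toContinuousLinearMap

theorem hasSum_synth (c : H4) : HasSum (fun k => c k • toL2 (e k)) (synth he c) := by
  have h := ((Orthonormal.orthogonalFamily he).hasSum_linearIsometry c).const_smul Real.pi
  have hpi := Real.pi_ne_zero
  convert! h using 2 with k
  simp [smul_smul, hpi, mul_comm]

theorem synth_single (k : ℕ+ × ℕ+) (r : ℝ) : synth he (lp.single 2 k r) = r • toL2 (e k) := by
  refine (hasSum_synth he _).unique ?_
  convert hasSum_single (α := L2Ω) k ?_ using 1
  · simp
  · intro l hl
    simp [hl]

theorem analysis_synth (c : H4) : analysis he (synth he c) = c := by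
  have hpi := Real.pi_ne_zero
  have h : ContinuousLinearMap.adjoint (modeIsometry he).toContinuousLinearMap
      ((modeIsometry he).toContinuousLinearMap c) = c :=
    congrArg (fun T : H4 →L[ℝ] H4 => T c)
      ((ContinuousLinearMap.norm_map_iff_adjoint_comp_self _).1 (modeIsometry he).norm_map)
  simp only [analysis, synth, _root_.smul_apply, map_smul, h, smul_smul]
  rw [one_div, mul_inv_cancel₀ hpi, one_smul]

theorem synth_analysis {f : L2Ω} (hf : f ∈ (synth he).range) : synth he (analysis he f) = f := by
  obtain ⟨c, rfl⟩ := hf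
  exact congrArg _ (analysis_synth he c)

theorem analysis_apply (f : L2Ω) (k : ℕ+ × ℕ+) :
    analysis he f k = 1 / Real.pi ^ 2 * ⟪toL2 (e k), f⟫ := by
  have h1 : analysis he f k = ⟪lp.single 2 k (1 : ℝ), analysis he f⟫ := by
    rw [lp.inner_single_left]; simp
  have h2 : (modeIsometry he).toContinuousLinearMap
      (lp.single 2 k (1 : ℝ)) = (1 / Real.pi) • toL2 (e k) := modeIsometry_single he k
  rw [h1, analysis, _root_.smul_apply, inner_smul_right, ContinuousLinearMap.adjoint_inner_right,
    h2, inner_smul_left]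
  simp only [conj_trivial]
  ring

/-- The range is the fixed-point set of a continuous map. Working inside this closed range makes
completeness of the sine system in `L²(Ω)` unnecessary. -/
theorem isClosed_range_synth : IsClosed ((synth he).range : Set L2Ω) := by
  have h : ((synth he).range : Set L2Ω) = {f | synth he (analysis he f) = f} := by
    ext f
    exact ⟨fun hf => synth_analysis he hf, fun hf => ⟨_, hf⟩⟩
  rw [h]
  exact isClosed_eq ((synth he).continuous.comp (analysis he).continuous) continuous_id

theorem toL2_mem_range (k : ℕ+ × ℕ+) : toL2 (e k) ∈ (synth he).range :=
  ⟨lp.single 2 k 1, by simp [synth_single]⟩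

end Synthesis

/-- Product formulas produce arbitrary integer frequencies; a zero frequency gives the zero function
and a negative one only changes the sign. -/
theorem toL2_ssB_mem_range (i j : ℤ) : toL2 (ssB i j) ∈ (synth isModeFamily_ssM).range := by
  have key : ∀ i j : ℕ, toL2 (ssB i j) ∈ (synth isModeFamily_ssM).range := fun i j => by
    rcases Nat.eq_zero_or_pos i with rfl | hi
    · have : ssB (0 : ℕ) j = 0 := by ext p; simp [ssB_apply, sn_zero_left]
      rw [this, map_zero]; exact zero_mem _
    rcases Nat.eq_zero_or_pos j with rfl | hj
    · have : ssB i (0 : ℕ) = 0 := by ext p; simp [ssB_apply, sn_zero_left]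
      rw [this, map_zero]; exact zero_mem _
    exact toL2_mem_range isModeFamily_ssM (⟨i, hi⟩, ⟨j, hj⟩)
  have hnegl : ∀ i j, ssB (-i) j = -ssB i j := fun i j => by
    ext p; simp [ssB_apply, sn_neg]
  have hnegr : ∀ i j, ssB i (-j) = -ssB i j := fun i j => by
    ext p; simp [ssB_apply, sn_neg]
  obtain ⟨i, rfl | rfl⟩ := i.eq_nat_or_neg <;> obtain ⟨j, rfl | rfl⟩ := j.eq_nat_or_neg
  · exact key i j
  · rw [hnegr, map_neg]; exact neg_mem (key i j)
  · rw [hnegl, map_neg]; exact neg_mem (key i j)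
  · rw [hnegl, hnegr, neg_neg]; exact key i j

/-- In each variable the product pairs one cosine with one sine, so it expands into sines alone.
This is why the Jacobian of two sine series is again a sine series. -/
theorem toL2_csB_mul_scB_mem_range (i j i' j' : ℤ) :
    toL2 (csB i j * scB i' j') ∈ (synth isModeFamily_ssM).range := by
  have h : csB i j * scB i' j' = (1 / 4 : ℝ) •
      (ssB (i + i') (j' + j) + ssB (i + i') (j - j') +
        (ssB (i' - i) (j' + j) + ssB (i' - i) (j - j'))) := by
    ext p
    simp only [BoundedContinuousFunction.coe_mul, Pi.mul_apply, csB_apply, scB_apply,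
      BoundedContinuousFunction.coe_smul, BoundedContinuousFunction.coe_add, Pi.add_apply,
      ssB_apply, smul_eq_mul]
    have h1 := cn_mul_sn i i' p.1
    have h2 := cn_mul_sn j' j p.2
    calc _ = (cn i p.1 * sn i' p.1) * (cn j' p.2 * sn j p.2) := by ring
      _ = _ := by rw [h1, h2]; ring
  rw [h, map_smul, map_add, map_add, map_add]
  exact Submodule.smul_mem _ _ (add_mem (add_mem (toL2_ssB_mem_range _ _) (toL2_ssB_mem_range _ _))
    (add_mem (toL2_ssB_mem_range _ _) (toL2_ssB_mem_range _ _)))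

/-! ### Weak derivatives of sine and cosine series -/

theorem isOpen_Ω : IsOpen Ω := isOpen_Ioo.prod isOpen_Ioo

theorem exists_bcf_of_hasCompactSupport {f : ℝ × ℝ → ℝ} (hf : Continuous f)
    (hs : HasCompactSupport f) : ∃ F : ℝ × ℝ →ᵇ ℝ, ∀ p, F p = f p := by
  obtain ⟨C, hC⟩ := hs.exists_bound_of_continuous hf
  exact ⟨BoundedContinuousFunction.ofNormedAddCommGroup f hf C hC, fun _ => rfl⟩

/-- The test function has compact support in `Ω`, so both integrals extend to the whole plane and
integration by parts has no boundary term. -/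
theorem setIntegral_mul_fderiv_eq {f f' φ : ℝ × ℝ → ℝ} {v : ℝ × ℝ} (hf : Continuous f)
    (hf' : Continuous f') (h : ∀ p, HasLineDerivAt ℝ f (f' p) p v) (hφ : ContDiff ℝ ∞ φ)
    (hc : HasCompactSupport φ) (hs : tsupport φ ⊆ Ω) :
    ∫ p in Ω, f p * fderiv ℝ φ p v = -∫ p in Ω, f' p * φ p := by
  have hdφ : Continuous fun p => fderiv ℝ φ p v :=
    (hφ.continuous_fderiv (by simp)).clm_apply continuous_const
  have hcd : HasCompactSupport fun p => fderiv ℝ φ p v :=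
    hc.fderiv_apply ℝ v
  rw [setIntegral_eq_integral_of_forall_compl_eq_zero, setIntegral_eq_integral_of_forall_compl_eq_zero]
  · refine integral_bilinear_hasLineDerivAt_right_eq_neg_left_of_integrable
      (B := ContinuousLinearMap.mul ℝ ℝ) ?_ ?_ ?_ (fun p _ => h p)
      (fun p _ => ((hφ.differentiable (by simp)) p).hasFDerivAt.hasLineDerivAt v)
    · exact (hf'.mul hφ.continuous).integrable_of_hasCompactSupport hc.mul_left
    · exact (hf.mul hdφ).integrable_of_hasCompactSupport hcd.mul_left
    · exact (hf.mul hφ.continuous).integrable_of_hasCompactSupport hc.mul_left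
  · intro p hp
    rw [image_eq_zero_of_notMem_tsupport fun hh => hp (hs hh), mul_zero]
  · intro p hp
    rw [fderiv_of_notMem_tsupport (𝕜 := ℝ) fun hh => hp (hs hh)]
    simp

/-- Against a fixed test function both sides are continuous linear functionals of the coefficient
families, so the identity for single modes can be summed. -/
theorem hasWeakPartial_synth {e e' : ℕ+ × ℕ+ → (ℝ × ℝ →ᵇ ℝ)} (he : IsModeFamily e)
    (he' : IsModeFamily e') {v : ℝ × ℝ} {r : ℕ+ × ℕ+ → ℝ}
    (hd : ∀ k p, HasLineDerivAt ℝ (e k) (r k * e' k p) p v) {c d : H4}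
    (hcd : ∀ k, d k = r k * c k) {f g : ℝ × ℝ → ℝ}
    (hf : f =ᵐ[volume.restrict Ω] synth he c) (hg : g =ᵐ[volume.restrict Ω] synth he' d) :
    HasWeakPartial v f g := by
  refine ⟨(Lp.memLp _).ae_eq hf.symm, (Lp.memLp _).ae_eq hg.symm, fun φ hφ hc hs => ?_⟩
  obtain ⟨F, hF⟩ := exists_bcf_of_hasCompactSupport hφ.continuous hc
  obtain ⟨G, hG⟩ := exists_bcf_of_hasCompactSupport
    ((hφ.continuous_fderiv (by simp)).clm_apply continuous_const) (hc.fderiv_apply ℝ v)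
  have h1 : ∫ p in Ω, f p * fderiv ℝ φ p v = ⟪toL2 G, synth he c⟫ := by
    rw [L2.inner_def]
    refine integral_congr_ae ?_
    filter_upwards [hf, coeFn_toL2 G] with p hp1 hp2
    rw [hp1, hp2, hG]; rfl
  have h2 : ∫ p in Ω, g p * φ p = ⟪toL2 F, synth he' d⟫ := by
    rw [L2.inner_def]
    refine integral_congr_ae ?_
    filter_upwards [hg, coeFn_toL2 F] with p hp1 hp2
    rw [hp1, hp2, hF]; rfl
  rw [h1, h2]
  have s1 := (hasSum_synth he c).mapL (innerSL ℝ (toL2 G))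
  have s2 := ((hasSum_synth he' d).mapL (innerSL ℝ (toL2 F))).neg
  refine s1.unique ?_
  convert! s2 using 2 with k
  simp only [innerSL_apply_apply, inner_smul_right, inner_toL2, hcd]
  have h3 := setIntegral_mul_fderiv_eq (f' := fun p => r k * e' k p) (e k).continuous
    (continuous_const.mul (e' k).continuous) (hd k) hφ hc hs
  have h4 : ∫ p in Ω, G p * e k p = ∫ p in Ω, e k p * fderiv ℝ φ p v := by
    simp only [hG, mul_comm]
  have h5 : r k * ∫ p in Ω, F p * e' k p = ∫ p in Ω, r k * e' k p * φ p := by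
    rw [← integral_const_mul]
    refine integral_congr_ae (Eventually.of_forall fun p => ?_)
    simp only [hF]; ring
  rw [h4, h3, ← h5]; ring

/-- Fundamental lemma of the calculus of variations: the difference of two weak derivatives
integrates to zero against every test function. -/
theorem HasWeakPartial.ae_unique {v : ℝ × ℝ} {f g f' g' : ℝ × ℝ → ℝ} (h : HasWeakPartial v f g)
    (h' : HasWeakPartial v f' g') (hff : f =ᵐ[volume.restrict Ω] f') :
    g =ᵐ[volume.restrict Ω] g' := by
  obtain ⟨-, hg, hI⟩ := h
  obtain ⟨-, hg', hI'⟩ := h'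
  have hgi : Integrable g (volume.restrict Ω) := hg.integrable (by norm_num)
  have hgi' : Integrable g' (volume.restrict Ω) := hg'.integrable (by norm_num)
  have key := isOpen_Ω.ae_eq_zero_of_integral_contDiff_smul_eq_zero (μ := volume)
    (f := fun p => g p - g' p) (IntegrableOn.locallyIntegrableOn (hgi.sub hgi'))
    (fun φ hφ hc hs => ?_)
  · rw [Filter.EventuallyEq, ae_restrict_iff' isOpen_Ω.measurableSet]
    filter_upwards [key] with p hp hpΩ
    linarith [hp hpΩ]
  · have e1 : ∫ p in Ω, f p * fderiv ℝ φ p v = ∫ p in Ω, f' p * fderiv ℝ φ p v := by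
      refine integral_congr_ae ?_
      filter_upwards [hff] with p hp
      rw [hp]
    have e2 := hI φ hφ hc hs
    have e3 := hI' φ hφ hc hs
    obtain ⟨C, hC⟩ := hc.exists_bound_of_continuous hφ.continuous
    have i1 : Integrable (fun p => g p * φ p) (volume.restrict Ω) :=
      hgi.mul_bdd hφ.continuous.aestronglyMeasurable (Eventually.of_forall hC)
    have i2 : Integrable (fun p => g' p * φ p) (volume.restrict Ω) :=
      hgi'.mul_bdd hφ.continuous.aestronglyMeasurable (Eventually.of_forall hC)
    rw [← setIntegral_eq_integral_of_forall_compl_eq_zero (s := Ω)]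
    · calc ∫ p in Ω, φ p • (g p - g' p) = ∫ p in Ω, (g p * φ p - g' p * φ p) := by
            refine integral_congr_ae (Eventually.of_forall fun p => ?_)
            simp only [smul_eq_mul]; ring
        _ = 0 := by rw [integral_sub i1 i2]; linarith
    · intro p hp
      rw [image_eq_zero_of_notMem_tsupport fun hh => hp (hs hh), zero_smul]

theorem hasLineDerivAt_fst_mul {f g f' : ℝ → ℝ} (hf : ∀ x, HasDerivAt f (f' x) x) (p : ℝ × ℝ) :
    HasLineDerivAt ℝ (fun p : ℝ × ℝ => f p.1 * g p.2) (f' p.1 * g p.2) p (1, 0) := by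
  have h1 : HasDerivAt (fun t : ℝ => f (p.1 + t)) (f' p.1) 0 := by
    have := (hf (p.1 + 0)).comp_const_add p.1 0
    simpa using this
  have h2 := h1.mul_const (g p.2)
  unfold HasLineDerivAt
  simpa using h2

theorem hasLineDerivAt_snd_mul {f g g' : ℝ → ℝ} (hg : ∀ x, HasDerivAt g (g' x) x) (p : ℝ × ℝ) :
    HasLineDerivAt ℝ (fun p : ℝ × ℝ => f p.1 * g p.2) (f p.1 * g' p.2) p (0, 1) := by
  have h1 : HasDerivAt (fun t : ℝ => g (p.2 + t)) (g' p.2) 0 := by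
    have := (hg (p.2 + 0)).comp_const_add p.2 0
    simpa using this
  have h2 := h1.const_mul (f p.1)
  unfold HasLineDerivAt
  simpa using h2

theorem hasLineDerivAt_ssM_fst (k : ℕ+ × ℕ+) (p : ℝ × ℝ) :
    HasLineDerivAt ℝ (ssM k) (((k.1 : ℕ) : ℝ) / 2 * csM k p) p (1, 0) := by
  have := hasLineDerivAt_fst_mul (g := sn (k.2 : ℕ)) (hasDerivAt_sn (k.1 : ℕ)) p
  rw [mul_assoc] at this
  simp only [Int.cast_natCast] at this
  exact this

theorem hasLineDerivAt_csM_fst (k : ℕ+ × ℕ+) (p : ℝ × ℝ) :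
    HasLineDerivAt ℝ (csM k) (-(((k.1 : ℕ) : ℝ) / 2) * ssM k p) p (1, 0) := by
  have := hasLineDerivAt_fst_mul (g := sn (k.2 : ℕ)) (hasDerivAt_cn (k.1 : ℕ)) p
  rw [← neg_mul, mul_assoc] at this
  simp only [Int.cast_natCast] at this
  exact this

theorem hasLineDerivAt_ssM_snd (k : ℕ+ × ℕ+) (p : ℝ × ℝ) :
    HasLineDerivAt ℝ (ssM k) (((k.2 : ℕ) : ℝ) / 2 * scM k p) p (0, 1) := by
  have := hasLineDerivAt_snd_mul (f := sn (k.1 : ℕ)) (hasDerivAt_sn (k.2 : ℕ)) p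
  rw [mul_left_comm] at this
  simp only [Int.cast_natCast] at this
  exact this

theorem hasLineDerivAt_scM_snd (k : ℕ+ × ℕ+) (p : ℝ × ℝ) :
    HasLineDerivAt ℝ (scM k) (-(((k.2 : ℕ) : ℝ) / 2) * ssM k p) p (0, 1) := by
  have := hasLineDerivAt_snd_mul (f := sn (k.1 : ℕ)) (hasDerivAt_cn (k.2 : ℕ)) p
  rw [← neg_mul, mul_left_comm] at this
  simp only [Int.cast_natCast] at this
  exact this

/-- The series with coefficients `c` in the sine modes. -/
noncomputable abbrev synS : H4 →L[ℝ] L2Ω := synth isModeFamily_ssM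

/-- The series with coefficients `c` in the modes `cos (n x / 2) sin (m y / 2)`. -/
noncomputable abbrev synC : H4 →L[ℝ] L2Ω := synth isModeFamily_csM

/-- The series with coefficients `c` in the modes `sin (n x / 2) cos (m y / 2)`. -/
noncomputable abbrev synD : H4 →L[ℝ] L2Ω := synth isModeFamily_scM

theorem hasWeakLaplacian_synS {c d : H4} {f : ℝ × ℝ → ℝ} (hcd : ∀ k, d k = -beta k * c k)
    (hf : f =ᵐ[volume.restrict Ω] synS c) : HasWeakLaplacian f (synS d) := by
  have hb1 : ∀ k : ℕ+ × ℕ+, |((k.1 : ℕ) : ℝ) / 2 / beta k| ≤ 2 := fun k => by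
    have h1 := half_fst_le k
    have h2 := half_le_beta k
    have h3 := beta_pos k
    rw [abs_of_nonneg (by positivity), div_le_iff₀ h3]
    linarith
  have hb2 : ∀ k : ℕ+ × ℕ+, |((k.2 : ℕ) : ℝ) / 2 / beta k| ≤ 2 := fun k => by
    have h1 := half_snd_le k
    have h2 := half_le_beta k
    have h3 := beta_pos k
    rw [abs_of_nonneg (by positivity), div_le_iff₀ h3]
    linarith
  have hb3 : ∀ k : ℕ+ × ℕ+, |(((k.1 : ℕ) : ℝ) / 2) ^ 2 / beta k| ≤ 1 := fun k => by
    have h3 := beta_pos k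
    rw [abs_of_nonneg (by positivity), div_le_iff₀ h3]
    unfold beta; nlinarith [sq_nonneg ((k.2 : ℕ) : ℝ)]
  have hb4 : ∀ k : ℕ+ × ℕ+, |(((k.2 : ℕ) : ℝ) / 2) ^ 2 / beta k| ≤ 1 := fun k => by
    have h3 := beta_pos k
    rw [abs_of_nonneg (by positivity), div_le_iff₀ h3]
    unfold beta; nlinarith [sq_nonneg ((k.1 : ℕ) : ℝ)]
  -- Only square-summability of `c` and `d = -βc` is available. The derivative coefficients are
  -- therefore built from `d` by bounded multipliers such as `(n/2)/β`, which also makes them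
  -- square-summable.
  let cx : H4 := -diag _ ⟨2, hb1⟩ d
  let cy : H4 := -diag _ ⟨2, hb2⟩ d
  let cxx : H4 := diag _ ⟨1, hb3⟩ d
  let cyy : H4 := diag _ ⟨1, hb4⟩ d
  have hx : ∀ k, cx k = ((k.1 : ℕ) : ℝ) / 2 * c k := fun k => by
    have h3 := (beta_pos k).ne'
    simp only [cx, lp.coeFn_neg, Pi.neg_apply, diag_apply, hcd]; field_simp
  have hy : ∀ k, cy k = ((k.2 : ℕ) : ℝ) / 2 * c k := fun k => by
    have h3 := (beta_pos k).ne'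
    simp only [cy, lp.coeFn_neg, Pi.neg_apply, diag_apply, hcd]; field_simp
  have hxx : ∀ k, cxx k = -(((k.1 : ℕ) : ℝ) / 2) * cx k := fun k => by
    have h3 := (beta_pos k).ne'
    simp only [hx, cxx, diag_apply, hcd]; field_simp
  have hyy : ∀ k, cyy k = -(((k.2 : ℕ) : ℝ) / 2) * cy k := fun k => by
    have h3 := (beta_pos k).ne'
    simp only [hy, cyy, diag_apply, hcd]; field_simp
  refine ⟨synC cx, synD cy, synS cxx, synS cyy,
    hasWeakPartial_synth _ _ hasLineDerivAt_ssM_fst hx hf ae_eq_rfl,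
    hasWeakPartial_synth _ _ hasLineDerivAt_csM_fst hxx ae_eq_rfl ae_eq_rfl,
    hasWeakPartial_synth _ _ hasLineDerivAt_ssM_snd hy hf ae_eq_rfl,
    hasWeakPartial_synth _ _ hasLineDerivAt_scM_snd hyy ae_eq_rfl ae_eq_rfl, ?_⟩
  have hd : d = cxx + cyy := by
    ext k
    rw [lp.coeFn_add, Pi.add_apply, hxx, hyy, hx, hy, hcd, beta]
    ring
  rw [hd, map_add]
  exact Lp.coeFn_add _ _

theorem HasWeakLaplacian.congr_right {f g g' : ℝ × ℝ → ℝ} (h : HasWeakLaplacian f g)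
    (hg : g' =ᵐ[volume.restrict Ω] g) : HasWeakLaplacian f g' := by
  obtain ⟨fx, fy, fxx, fyy, h1, h2, h3, h4, h5⟩ := h
  refine ⟨fx, fy, fxx, fyy, h1, h2, h3, h4, ?_⟩
  filter_upwards [h5, hg] with p hp hp'
  rw [hp', hp]

theorem HasWeakLaplacian.ae_unique {f g f' g' : ℝ × ℝ → ℝ} (h : HasWeakLaplacian f g)
    (h' : HasWeakLaplacian f' g') (hff : f =ᵐ[volume.restrict Ω] f') :
    g =ᵐ[volume.restrict Ω] g' := by
  obtain ⟨fx, fy, fxx, fyy, h1, h2, h3, h4, h5⟩ := h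
  obtain ⟨fx', fy', fxx', fyy', h1', h2', h3', h4', h5'⟩ := h'
  filter_upwards [h5, h5', h2.ae_unique h2' (h1.ae_unique h1' hff),
    h4.ae_unique h4' (h3.ae_unique h3' hff)] with p a b c d
  rw [a, b, c, d]

/-! ### The Jacobian as a continuous bilinear map -/

/-- The weights of `ψ`, its first derivatives and `Δψ` are all dominated by `1/β`, so for `ψ ∈ H⁴`
these four series converge uniformly. -/
theorem summable_sq_of_abs_le {c : ℕ+ × ℕ+ → ℝ} (h : ∀ k, |c k| ≤ 1 / beta k) :
    Summable fun k => c k ^ 2 :=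
  Summable.of_nonneg_of_le (fun k => sq_nonneg _)
    (fun k => by rw [← sq_abs]; gcongr; exact h k) summable_inv_beta_sq

theorem inv_beta_le_two (k : ℕ+ × ℕ+) : 1 / beta k ≤ 2 := by
  rw [div_le_iff₀ (beta_pos k)]; linarith [half_le_beta k]

/-- The weight of a function in `H⁴`. -/
noncomputable def w0 (k : ℕ+ × ℕ+) : ℝ := 1 / (1 + beta k ^ 2)

/-- The weight of an `x`-derivative in `H⁴`. -/
noncomputable def wx (k : ℕ+ × ℕ+) : ℝ := ((k.1 : ℕ) : ℝ) / 2 / (1 + beta k ^ 2)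

/-- The weight of a `y`-derivative in `H⁴`. -/
noncomputable def wy (k : ℕ+ × ℕ+) : ℝ := ((k.2 : ℕ) : ℝ) / 2 / (1 + beta k ^ 2)

/-- The weight of the Laplacian in `H⁴`. -/
noncomputable def wl (k : ℕ+ × ℕ+) : ℝ := -beta k / (1 + beta k ^ 2)

theorem abs_w0_le (k : ℕ+ × ℕ+) : |w0 k| ≤ 1 / beta k := by
  have hb := beta_pos k
  rw [w0, abs_of_nonneg (by positivity)]
  gcongr
  nlinarith [sq_nonneg (beta k - 1)]

theorem abs_wx_le (k : ℕ+ × ℕ+) : |wx k| ≤ 1 / beta k := by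
  have hb := beta_pos k
  have := half_fst_le k
  rw [wx, abs_of_nonneg (by positivity), div_le_div_iff₀ (by positivity) hb]
  nlinarith [sq_nonneg (beta k - 1)]

theorem abs_wy_le (k : ℕ+ × ℕ+) : |wy k| ≤ 1 / beta k := by
  have hb := beta_pos k
  have := half_snd_le k
  rw [wy, abs_of_nonneg (by positivity), div_le_div_iff₀ (by positivity) hb]
  nlinarith [sq_nonneg (beta k - 1)]

theorem abs_wl_le (k : ℕ+ × ℕ+) : |wl k| ≤ 1 / beta k := by
  have hb := beta_pos k
  rw [wl, neg_div, abs_neg, abs_of_nonneg (by positivity), div_le_div_iff₀ (by positivity) hb]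
  nlinarith

theorem exists_bound_of_abs_le {c : ℕ+ × ℕ+ → ℝ} (h : ∀ k, |c k| ≤ 1 / beta k) :
    ∃ C, ∀ k, |c k| ≤ C := ⟨2, fun k => (h k).trans (inv_beta_le_two k)⟩

/-- The continuous representative of `ψ ∈ H⁴`. -/
noncomputable def toBCF : H4 →L[ℝ] (ℝ × ℝ →ᵇ ℝ) :=
  series w0 (summable_sq_of_abs_le abs_w0_le) ssM norm_ssM_le

/-- `∂ₓ ψ`. -/
noncomputable def gradX : H4 →L[ℝ] (ℝ × ℝ →ᵇ ℝ) :=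
  series wx (summable_sq_of_abs_le abs_wx_le) csM norm_csM_le

/-- `∂_y ψ`. -/
noncomputable def gradY : H4 →L[ℝ] (ℝ × ℝ →ᵇ ℝ) :=
  series wy (summable_sq_of_abs_le abs_wy_le) scM norm_scM_le

/-- The continuous representative of `Δψ`. -/
noncomputable def lapBCF : H4 →L[ℝ] (ℝ × ℝ →ᵇ ℝ) :=
  series wl (summable_sq_of_abs_le abs_wl_le) ssM norm_ssM_le

theorem toBCF_apply (ψ : H4) (p : ℝ × ℝ) : toBCF ψ p = toFun ψ p := by
  rw [toBCF, series_apply, toFun]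
  refine tsum_congr fun k => ?_
  rw [ssM_apply, coeff, w0]; ring

theorem toL2_series {c : ℕ+ × ℕ+ → ℝ} (hc : Summable fun k => c k ^ 2) (hb : ∃ C, ∀ k, |c k| ≤ C)
    {e : ℕ+ × ℕ+ → (ℝ × ℝ →ᵇ ℝ)} (he : ∀ k, ‖e k‖ ≤ 1) (hm : IsModeFamily e) (ψ : H4) :
    toL2 (series c hc e he ψ) = synth hm (diag c hb ψ) := by
  have : toL2.comp (series c hc e he) = (synth hm).comp (diag c hb) :=
    eq_of_apply_single fun k => by
      simp only [ContinuousLinearMap.comp_apply, series_single, diag_single, synth_single, map_smul]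
  exact congrArg (fun T : H4 →L[ℝ] L2Ω => T ψ) this

theorem ae_eq_synth_of_series {c : ℕ+ × ℕ+ → ℝ} (hc : Summable fun k => c k ^ 2)
    (hb : ∃ C, ∀ k, |c k| ≤ C) {e : ℕ+ × ℕ+ → (ℝ × ℝ →ᵇ ℝ)} (he : ∀ k, ‖e k‖ ≤ 1)
    (hm : IsModeFamily e) (ψ : H4) :
    series c hc e he ψ =ᵐ[volume.restrict Ω] synth hm (diag c hb ψ) := by
  rw [← toL2_series hc hb he hm]
  exact (coeFn_toL2 _).symm

/-- The coefficients of `ψ ∈ H⁴`. -/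
noncomputable abbrev cf0 : H4 →L[ℝ] H4 := diag w0 (exists_bound_of_abs_le abs_w0_le)

/-- The coefficients of the Laplacian of `ψ ∈ H⁴`. -/
noncomputable abbrev cfl : H4 →L[ℝ] H4 := diag wl (exists_bound_of_abs_le abs_wl_le)

theorem toBCF_ae (ψ : H4) : toBCF ψ =ᵐ[volume.restrict Ω] synS (cf0 ψ) :=
  ae_eq_synth_of_series _ _ _ _ _

theorem lapBCF_ae (ψ : H4) : lapBCF ψ =ᵐ[volume.restrict Ω] synS (cfl ψ) :=
  ae_eq_synth_of_series _ _ _ _ _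

/-- The weight of a function in the space of families with `(1 + β) v` square-summable. -/
noncomputable def v0 (k : ℕ+ × ℕ+) : ℝ := 1 / (1 + beta k)

/-- The weight of an `x`-derivative in the space of families with `(1 + β) v` square-summable. -/
noncomputable def vx (k : ℕ+ × ℕ+) : ℝ := ((k.1 : ℕ) : ℝ) / 2 / (1 + beta k)

/-- The weight of a `y`-derivative in the space of families with `(1 + β) v` square-summable. -/
noncomputable def vy (k : ℕ+ × ℕ+) : ℝ := ((k.2 : ℕ) : ℝ) / 2 / (1 + beta k)

theorem bound_v0 : ∃ C, ∀ k, |v0 k| ≤ C := ⟨1, fun k => by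
  have hb := beta_pos k
  rw [v0, abs_of_nonneg (by positivity), div_le_iff₀ (by positivity)]
  linarith⟩

theorem bound_vx : ∃ C, ∀ k, |vx k| ≤ C := ⟨1, fun k => by
  have hb := beta_pos k
  have := half_fst_le k
  rw [vx, abs_of_nonneg (by positivity), div_le_iff₀ (by positivity)]
  linarith⟩

theorem bound_vy : ∃ C, ∀ k, |vy k| ≤ C := ⟨1, fun k => by
  have hb := beta_pos k
  have := half_snd_le k
  rw [vy, abs_of_nonneg (by positivity), div_le_iff₀ (by positivity)]
  linarith⟩

/-- The `L²` function with coefficients `v_k / (1 + β_k)`. -/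
noncomputable def vorS : H4 →L[ℝ] L2Ω := synS.comp (diag v0 bound_v0)

/-- The `x`-derivative of `vorS`. -/
noncomputable def vorX : H4 →L[ℝ] L2Ω := synC.comp (diag vx bound_vx)

/-- The `y`-derivative of `vorS`. -/
noncomputable def vorY : H4 →L[ℝ] L2Ω := synD.comp (diag vy bound_vy)

/-- `J(φ, v) = ∂ₓ φ ∂_y v - ∂_y φ ∂ₓ v`. -/
noncomputable def jac : H4 →L[ℝ] H4 →L[ℝ] L2Ω :=
  mulL.bilinearComp gradX vorY - mulL.bilinearComp gradY vorX

theorem jac_apply (φ v : H4) :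
    jac φ v = mulL (gradX φ) (vorY v) - mulL (gradY φ) (vorX v) := rfl

theorem jac_ae (φ v : H4) : jac φ v =ᵐ[volume.restrict Ω]
    fun p => gradX φ p * vorY v p - gradY φ p * vorX v p := by
  rw [jac_apply]
  filter_upwards [Lp.coeFn_sub (mulL (gradX φ) (vorY v)) (mulL (gradY φ) (vorX v)),
    coeFn_mulL (gradX φ) (vorY v), coeFn_mulL (gradY φ) (vorX v)] with p h1 h2 h3
  rw [h1, Pi.sub_apply, h2, h3]

theorem hasJacobian_jac {φ v : H4} {f g : ℝ × ℝ → ℝ} (hf : f =ᵐ[volume.restrict Ω] toBCF φ)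
    (hg : g =ᵐ[volume.restrict Ω] vorS v) : HasJacobian f g (jac φ v) := by
  refine ⟨gradX φ, gradY φ, vorX v, vorY v, ?_, ?_, ?_, ?_, jac_ae φ v⟩
  · refine hasWeakPartial_synth _ isModeFamily_csM hasLineDerivAt_ssM_fst
      (d := diag wx (exists_bound_of_abs_le abs_wx_le) φ) (fun k => ?_) (hf.trans (toBCF_ae φ))
      (ae_eq_synth_of_series _ _ _ _ _)
    rw [diag_apply, diag_apply, wx, w0]; ring
  · refine hasWeakPartial_synth _ isModeFamily_scM hasLineDerivAt_ssM_snd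
      (d := diag wy (exists_bound_of_abs_le abs_wy_le) φ) (fun k => ?_) (hf.trans (toBCF_ae φ))
      (ae_eq_synth_of_series _ _ _ _ _)
    rw [diag_apply, diag_apply, wy, w0]; ring
  · refine hasWeakPartial_synth isModeFamily_ssM isModeFamily_csM hasLineDerivAt_ssM_fst
      (c := diag v0 bound_v0 v) (d := diag vx bound_vx v) (fun k => ?_) hg ae_eq_rfl
    rw [diag_apply, diag_apply, vx, v0]; ring
  · refine hasWeakPartial_synth isModeFamily_ssM isModeFamily_scM hasLineDerivAt_ssM_snd
      (c := diag v0 bound_v0 v) (d := diag vy bound_vy v) (fun k => ?_) hg ae_eq_rfl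
    rw [diag_apply, diag_apply, vy, v0]; ring

theorem HasJacobian.ae_unique {f g j f' g' j' : ℝ × ℝ → ℝ} (h : HasJacobian f g j)
    (h' : HasJacobian f' g' j') (hf : f =ᵐ[volume.restrict Ω] f')
    (hg : g =ᵐ[volume.restrict Ω] g') : j =ᵐ[volume.restrict Ω] j' := by
  obtain ⟨fx, fy, gx, gy, h1, h2, h3, h4, h5⟩ := h
  obtain ⟨fx', fy', gx', gy', h1', h2', h3', h4', h5'⟩ := h'
  filter_upwards [h5, h5', h1.ae_unique h1' hf, h2.ae_unique h2' hf, h3.ae_unique h3' hg,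
    h4.ae_unique h4' hg] with p a b c d e f
  rw [a, b, c, d, e, f]

/-- One derivative of the vorticity has a weight tending to zero, hence is compact; multiplication
by the bounded gradient of `φ` preserves compactness. -/
theorem isCompactOperator_jac (φ : H4) : IsCompactOperator (jac φ) := by
  have h1 : IsCompactOperator (mulL (gradX φ) ∘ synD ∘ diag vy bound_vy) :=
    ((isCompactOperator_diag vy bound_vy tendsto_snd_weight).clm_comp synD).clm_comp
      (mulL (gradX φ))
  have h2 : IsCompactOperator (mulL (gradY φ) ∘ synC ∘ diag vx bound_vx) :=
    ((isCompactOperator_diag vx bound_vx tendsto_fst_weight).clm_comp synC).clm_comp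
      (mulL (gradY φ))
  exact h1.sub h2

theorem jac_single (k l : ℕ+ × ℕ+) :
    jac (lp.single 2 k 1) (lp.single 2 l 1) =
      (wx k * vy l) • toL2 (csM k * scM l) - (wy k * vx l) • toL2 (csM l * scM k) := by
  simp only [jac_apply, gradX, gradY, vorX, vorY, series_single, ContinuousLinearMap.comp_apply,
    diag_single, synth_single, mul_one, map_smul, _root_.smul_apply, mulL_toL2, smul_smul]
  rw [mul_comm (vy l), mul_comm (vx l), mul_comm (scM k)]

theorem jac_mem_range (φ v : H4) : jac φ v ∈ synS.range := by
  have h1 : ∀ k, jac (lp.single 2 k 1) v ∈ synS.range := fun k =>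
    mem_of_apply_single (isClosed_range_synth _) (fun l => by
      rw [jac_single]
      exact sub_mem (Submodule.smul_mem _ _ (toL2_csB_mul_scB_mem_range _ _ _ _))
        (Submodule.smul_mem _ _ (toL2_csB_mul_scB_mem_range _ _ _ _))) v
  exact mem_of_apply_single (f := jac.flip v) (isClosed_range_synth _) h1 φ

/-- The sine coefficients of an `L²` function. -/
noncomputable abbrev anS : L2Ω →L[ℝ] H4 := analysis isModeFamily_ssM

/-- The sine coefficients of the Jacobian. -/
noncomputable def jacC : H4 →L[ℝ] H4 →L[ℝ] H4 := (ContinuousLinearMap.compL ℝ H4 L2Ω H4 anS).comp jac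

theorem jacC_apply (φ v : H4) : jacC φ v = anS (jac φ v) := rfl

theorem synS_jacC (φ v : H4) : synS (jacC φ v) = jac φ v :=
  synth_analysis _ (jac_mem_range φ v)

/-! ### Coupling coefficients of the modes -/

/-- `∫ cos (a x / 2) sin (b x / 2) sin (c x / 2) dx` over a period. -/
noncomputable def tri (a b c : ℤ) : ℝ := perInt fun x => cn a x * sn b x * sn c x

theorem tri_comm (a b c : ℤ) : tri a b c = tri a c b := by
  unfold tri; congr 1; funext x; ring

theorem inner_ssM_csM_mul_scM (q k l : ℕ+ × ℕ+) :
    ⟪toL2 (ssM q), toL2 (csM k * scM l)⟫ =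
      tri (k.1 : ℕ) (l.1 : ℕ) (q.1 : ℕ) * tri (l.2 : ℕ) (k.2 : ℕ) (q.2 : ℕ) := by
  rw [inner_toL2, tri, tri, ← integral_tensor]
  refine integral_congr_ae (Eventually.of_forall fun p => ?_)
  simp only [BoundedContinuousFunction.coe_mul, Pi.mul_apply, ssM, csM, scM, ssB_apply, csB_apply,
    scB_apply]
  ring

/-- The coefficient of the mode `q` in `J(mode_k, mode_l)`, times `π²`. -/
noncomputable def coupling (k l q : ℕ+ × ℕ+) : ℝ :=
  ((k.1 : ℕ) : ℝ) / 2 * (((l.2 : ℕ) : ℝ) / 2) *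
      (tri (k.1 : ℕ) (l.1 : ℕ) (q.1 : ℕ) * tri (l.2 : ℕ) (k.2 : ℕ) (q.2 : ℕ)) -
    ((k.2 : ℕ) : ℝ) / 2 * (((l.1 : ℕ) : ℝ) / 2) *
      (tri (l.1 : ℕ) (k.1 : ℕ) (q.1 : ℕ) * tri (k.2 : ℕ) (l.2 : ℕ) (q.2 : ℕ))

theorem jacC_single_apply (k l q : ℕ+ × ℕ+) :
    jacC (lp.single 2 k 1) (lp.single 2 l 1) q =
      1 / Real.pi ^ 2 * (w0 k * v0 l) * coupling k l q := by
  rw [jacC_apply, analysis_apply, jac_single, inner_sub_right, inner_smul_right, inner_smul_right,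
    inner_ssM_csM_mul_scM, inner_ssM_csM_mul_scM, coupling, wx, wy, w0, vx, vy, v0]
  ring

theorem bilin_eq_of_apply_single {F : Type*} [NormedAddCommGroup F] [NormedSpace ℝ F]
    {f g : H4 →L[ℝ] H4 →L[ℝ] F}
    (h : ∀ k l, f (lp.single 2 k 1) (lp.single 2 l 1) = g (lp.single 2 k 1) (lp.single 2 l 1)) :
    f = g :=
  eq_of_apply_single fun k => eq_of_apply_single fun l => h k l

theorem coupling_antisymm_left (k l q : ℕ+ × ℕ+) : coupling k l q = -coupling l k q := by
  simp only [coupling]; ring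

theorem bound_incl : ∃ C, ∀ k : ℕ+ × ℕ+, |(1 + beta k) / (1 + beta k ^ 2)| ≤ C := ⟨2, fun k => by
  have hb := beta_pos k
  rw [abs_of_nonneg (by positivity), div_le_iff₀ (by positivity)]
  nlinarith [sq_nonneg (beta k - 1)]⟩

theorem bound_lap : ∃ C, ∀ k : ℕ+ × ℕ+, |-beta k * (1 + beta k) / (1 + beta k ^ 2)| ≤ C :=
  ⟨2, fun k => by
    have hb := beta_pos k
    rw [neg_mul, neg_div, abs_neg, abs_of_nonneg (by positivity), div_le_iff₀ (by positivity)]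
    nlinarith [sq_nonneg (beta k - 1)]⟩

/-- The inclusion of `H⁴` in the space of families with `(1 + β) v` square-summable. -/
noncomputable def incl : H4 →L[ℝ] H4 := diag _ bound_incl

/-- The Laplacian from `H⁴` to the space of families with `(1 + β) v` square-summable. -/
noncomputable def lap : H4 →L[ℝ] H4 := diag _ bound_lap

theorem vorS_incl (ψ : H4) : vorS (incl ψ) = synS (cf0 ψ) := by
  rw [vorS, ContinuousLinearMap.comp_apply]
  congr 1
  ext k
  have hb := beta_pos k
  have : 1 + beta k ≠ 0 := by positivity
  rw [diag_apply, incl, diag_apply, diag_apply, v0, w0]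
  field_simp

theorem vorS_lap (ψ : H4) : vorS (lap ψ) = synS (cfl ψ) := by
  rw [vorS, ContinuousLinearMap.comp_apply]
  congr 1
  ext k
  have hb := beta_pos k
  have : 1 + beta k ≠ 0 := by positivity
  rw [diag_apply, lap, diag_apply, diag_apply, v0, wl]
  field_simp

/-- This is `J(φ, χ) = -J(χ, φ)`. The map `incl` appears because the second argument is stored with
the weight `1 + β` instead of `1 + β²`. -/
theorem jacC_incl_antisymm (φ χ : H4) : jacC φ (incl χ) = -jacC χ (incl φ) := by
  have : jacC.bilinearComp (ContinuousLinearMap.id ℝ H4) incl =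
      -(jacC.bilinearComp (ContinuousLinearMap.id ℝ H4) incl).flip := by
    refine bilin_eq_of_apply_single fun k l => ?_
    simp only [ContinuousLinearMap.bilinearComp_apply, ContinuousLinearMap.coe_id', id,
      _root_.neg_apply, ContinuousLinearMap.flip_apply, incl, diag_single]
    have hs : ∀ (k : ℕ+ × ℕ+) (r : ℝ), (lp.single 2 k (r * 1) : H4) = r • lp.single 2 k (1 : ℝ) :=
      fun k r => by rw [← lp.single_smul]; simp
    simp only [hs, map_smul]
    ext q
    simp only [lp.coeFn_neg, lp.coeFn_smul, Pi.neg_apply, Pi.smul_apply, smul_eq_mul,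
      jacC_single_apply]
    rw [coupling_antisymm_left k l q, w0, v0, w0, v0]
    have hk : 1 + beta k ≠ 0 := by linarith [beta_pos k]
    have hl : 1 + beta l ≠ 0 := by linarith [beta_pos l]
    field_simp
  exact congrArg (fun T : H4 →L[ℝ] H4 →L[ℝ] H4 => T φ χ) this

/-! ### The linearised operator -/

/-- The element of `H⁴` representing `sin x sin y`. -/
noncomputable def base : H4 := (5 : ℝ) • lp.single 2 ((2, 2) : ℕ+ × ℕ+) (1 : ℝ)

theorem beta_two_two : beta (2, 2) = 2 := by simp only [beta]; norm_num

theorem toBCF_base (p : ℝ × ℝ) : toBCF base p = psi0 p := by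
  -- The weight at `β = 2` is `1/(1 + 2²)`, which cancels the factor `5` in `base`.
  rw [base, map_smul, toBCF, series_single, w0, beta_two_two]
  simp only [BoundedContinuousFunction.coe_smul, ssM_apply, mode, psi0, smul_eq_mul]
  norm_num
  ring

/-- The map `(2 + Δ)` on `H⁴`. -/
noncomputable def twoAddLap : H4 →L[ℝ] H4 := (2 : ℝ) • incl + lap

theorem twoAddLap_single (k : ℕ+ × ℕ+) : twoAddLap (lp.single 2 k 1) =
    ((2 - beta k) * (1 + beta k) / (1 + beta k ^ 2)) • lp.single 2 k (1 : ℝ) := by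
  rw [← lp.single_smul]
  ext l
  simp only [twoAddLap, _root_.add_apply, _root_.smul_apply, incl, lap, diag_single, lp.coeFn_add,
    lp.coeFn_smul, Pi.add_apply, Pi.smul_apply, smul_eq_mul, mul_one]
  by_cases h : l = k
  · subst h; simp; ring
  · simp [h]

/-- The coefficients of `J(ψ₀, (2 + Δ) ψ)`. -/
noncomputable def advect : H4 →L[ℝ] H4 := (jacC base).comp twoAddLap

theorem advect_single_apply (l q : ℕ+ × ℕ+) : advect (lp.single 2 l 1) q =
    1 / Real.pi ^ 2 * ((2 - beta l) / (1 + beta l ^ 2)) * coupling (2, 2) l q := by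
  rw [advect, ContinuousLinearMap.comp_apply, twoAddLap_single, base]
  simp only [map_smul, _root_.smul_apply, lp.coeFn_smul, Pi.smul_apply, smul_eq_mul,
    jacC_single_apply]
  have hl : 1 + beta l ≠ 0 := by linarith [beta_pos l]
  have hl2 := (one_add_beta_sq_pos l).ne'
  rw [w0, v0, beta_two_two]
  field_simp
  norm_num

theorem bound_twoAdd : ∃ C, ∀ k : ℕ+ × ℕ+, |(2 - beta k) / (1 + beta k ^ 2)| ≤ C :=
  ⟨2, fun k => by
    have hb := beta_pos k
    rw [abs_div, abs_of_pos (one_add_beta_sq_pos k), div_le_iff₀ (one_add_beta_sq_pos k), abs_le]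
    constructor <;> nlinarith [sq_nonneg (beta k - 1)]⟩

/-- The coefficients of `(2 + Δ) ψ`. -/
noncomputable def cfTwoAddLap : H4 →L[ℝ] H4 := diag _ bound_twoAdd

/-- Transport by the divergence-free field of `ψ₀` is skew-symmetric in `L²`. On coefficients this
is the Leibniz identity in each variable, used to eliminate the terms where a cosine carries the
frequency of `q`. -/
theorem coupling_base_antisymm (l q : ℕ+ × ℕ+) :
    coupling (2, 2) l q = -coupling (2, 2) q l := by
  have h1 := perInt_leibniz 2 (l.1 : ℕ) (q.1 : ℕ)
  have h2 := perInt_leibniz 2 (l.2 : ℕ) (q.2 : ℕ)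
  change (2 : ℤ) / (2 : ℝ) * tri _ _ _ + _ * tri _ _ _ + _ * tri _ _ _ = 0 at h1 h2
  simp only [coupling]
  have e2 : (((2 : ℕ+) : ℕ) : ℤ) = 2 := rfl
  have e2' : (((2 : ℕ+) : ℕ) : ℝ) = 2 := by norm_num
  rw [e2, e2', tri_comm 2 (q.1 : ℕ) (l.1 : ℕ), tri_comm 2 (q.2 : ℕ) (l.2 : ℕ)]
  push_cast at h1 h2
  linear_combination tri 2 (l.1 : ℕ) (q.1 : ℕ) * h2 - tri 2 (l.2 : ℕ) (q.2 : ℕ) * h1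

/-- Skewness of `J(ψ₀, ·)`, applied to `(2 + Δ)φ` and `(2 + Δ)χ`; the `ℓ²` product of coefficients
is the `L²` product up to a constant. -/
theorem inner_advect_antisymm (φ χ : H4) :
    ⟪advect φ, cfTwoAddLap χ⟫ = -⟪advect χ, cfTwoAddLap φ⟫ := by
  have : (innerSL ℝ).bilinearComp advect cfTwoAddLap =
      -((innerSL ℝ).bilinearComp advect cfTwoAddLap).flip := by
    refine bilin_eq_of_apply_single fun k l => ?_
    simp only [ContinuousLinearMap.bilinearComp_apply, _root_.neg_apply,
      ContinuousLinearMap.flip_apply, innerSL_apply_apply, cfTwoAddLap, diag_single,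
      lp.inner_single_right, advect_single_apply, coupling_base_antisymm k l]
    simp only [RCLike.inner_apply, conj_trivial]
    ring
  exact congrArg (fun T : H4 →L[ℝ] H4 →L[ℝ] ℝ => T φ χ) this

/-! ### The viscous multiplier and its inverse -/

section Viscous

variable {ν μ : ℝ} (hν : 0 < ν) (hμ : 0 ≤ μ)

theorem viscous_pos (hν : 0 < ν) (hμ : 0 ≤ μ) (k : ℕ+ × ℕ+) :
    0 < μ * beta k + ν * beta k ^ 2 := by
  have hb := beta_pos k
  positivity

theorem bound_viscous (ν μ : ℝ) :
    ∃ C, ∀ k : ℕ+ × ℕ+, |(μ * beta k + ν * beta k ^ 2) / (1 + beta k ^ 2)| ≤ C :=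
  ⟨|μ| + |ν|, fun k => by
    have hb := beta_pos k
    rw [abs_div, abs_of_pos (one_add_beta_sq_pos k), div_le_iff₀ (one_add_beta_sq_pos k)]
    refine (abs_add_le _ _).trans ?_
    rw [abs_mul, abs_mul, abs_of_pos hb, abs_of_pos (by positivity : 0 < beta k ^ 2)]
    nlinarith [mul_nonneg (abs_nonneg μ) (by nlinarith [sq_nonneg (beta k - 1)] :
      (0 : ℝ) ≤ 1 + beta k ^ 2 - beta k), abs_nonneg ν]⟩

theorem bound_viscous_inv (hν : 0 < ν) (hμ : 0 ≤ μ) :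
    ∃ C, ∀ k : ℕ+ × ℕ+, |(1 + beta k ^ 2) / (μ * beta k + ν * beta k ^ 2)| ≤ C :=
  -- Since `β ≥ 1/2`, one has `1 ≤ 4β²`, hence `1 + β² ≤ 5β²`.
  ⟨5 / ν, fun k => by
    have hb := beta_pos k
    have hb2 := half_le_beta k
    have hp := viscous_pos hν hμ k
    rw [abs_of_nonneg (by positivity), div_le_div_iff₀ hp hν]
    nlinarith [mul_nonneg hμ hb.le, mul_nonneg hν.le (by nlinarith : 0 ≤ beta k ^ 2 - 1 / 4)]⟩

/-- The coefficients of `-μ Δψ + ν Δ²ψ`. -/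
noncomputable def viscous (ν μ : ℝ) : H4 →L[ℝ] H4 := diag _ (bound_viscous ν μ)

/-- The inverse of `viscous`. -/
noncomputable def viscousInv : H4 →L[ℝ] H4 := diag _ (bound_viscous_inv hν hμ)

theorem viscousInv_viscous (ψ : H4) : viscousInv hν hμ (viscous ν μ ψ) = ψ := by
  ext k
  have h1 := (viscous_pos hν hμ k).ne'
  have h2 := (one_add_beta_sq_pos k).ne'
  rw [viscousInv, viscous, diag_apply, diag_apply, ← mul_assoc, div_mul_div_cancel₀ (by assumption),
    div_self (by assumption), one_mul]

theorem viscous_viscousInv (ψ : H4) : viscous ν μ (viscousInv hν hμ ψ) = ψ := by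
  ext k
  have h1 := (viscous_pos hν hμ k).ne'
  have h2 := (one_add_beta_sq_pos k).ne'
  rw [viscousInv, viscous, diag_apply, diag_apply, ← mul_assoc, div_mul_div_cancel₀ (by assumption),
    div_self (by assumption), one_mul]

theorem eq_zero_of_viscous_eq_zero (hν : 0 < ν) (hμ : 0 ≤ μ) {ψ : H4} (h : viscous ν μ ψ = 0) :
    ψ = 0 := by
  rw [← viscousInv_viscous hν hμ ψ, h, map_zero]

end Viscous

/-! ### Parity classes and the symmetry that reverses the basic flow -/

/-- The operator `ψ ↦ (ψ_{π k})_k`. -/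
noncomputable def permOp (π : Equiv.Perm (ℕ+ × ℕ+)) : H4 →L[ℝ] H4 :=
  LinearMap.mkContinuous
    { toFun := fun ψ => ⟨fun k => ψ (π k), memℓp_gen (by
        have := (lp.memℓp ψ).summable (by norm_num)
        exact this.comp_injective π.injective)⟩
      map_add' := fun _ _ => rfl
      map_smul' := fun _ _ => rfl } 1 fun ψ => by
    have h := lp.norm_rpow_eq_tsum (p := 2) (by norm_num) ψ
    refine le_of_eq ?_
    rw [one_mul]
    refine Real.rpow_left_injOn (x := (2 : ENNReal).toReal) (by norm_num)
      (norm_nonneg _) (norm_nonneg _) ?_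
    simp only
    rw [h, lp.norm_rpow_eq_tsum (p := 2) (by norm_num)]
    exact π.tsum_eq fun k => ‖ψ k‖ ^ (2 : ENNReal).toReal

theorem permOp_apply (π : Equiv.Perm (ℕ+ × ℕ+)) (ψ : H4) (k : ℕ+ × ℕ+) :
    permOp π ψ k = ψ (π k) := rfl

/-- The data of a class `I` of modes that is closed under the Jacobian, and of a signed involution
`k ↦ π k` of the modes, with signs `s k`, that reverses the advection by the basic flow on `I`.
The class contains at most one mode `k₀` with `β < 2`. -/
structure FlowSymmetry where
  /-- the class of modes -/
  I : ℕ+ × ℕ+ → Prop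
  /-- the permutation of the modes -/
  π : Equiv.Perm (ℕ+ × ℕ+)
  /-- the signs -/
  s : ℕ+ × ℕ+ → ℝ
  /-- the mode with `β < 2` -/
  k₀ : ℕ+ × ℕ+
  coupling_eq_zero : ∀ k l q, I k → I l → ¬ I q → coupling k l q = 0
  mem_base : I (2, 2)
  π_π : ∀ k, π (π k) = k
  s_sq : ∀ k, s k ^ 2 = 1
  s_π : ∀ k, s (π k) = s k
  mem_π : ∀ k, I (π k) ↔ I k
  beta_π : ∀ k, beta (π k) = beta k
  π_k₀ : π k₀ = k₀
  s_k₀ : s k₀ = 1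
  π_base : π (2, 2) = (2, 2)
  -- On modes, this says that the signed permutation anticommutes with advection by the basic flow.
  anticomm : ∀ l q, I l → s l * coupling (2, 2) (π l) q = -(s q * coupling (2, 2) l (π q))
  two_lt_beta : ∀ k, I k → k ≠ k₀ → k ≠ (2, 2) → 2 < beta k

namespace FlowSymmetry

variable (S : FlowSymmetry)

open Classical in
/-- The projection on the modes of the class. -/
noncomputable def proj : H4 →L[ℝ] H4 := diag (fun k => if S.I k then 1 else 0)
  ⟨1, fun k => by split_ifs <;> simp⟩

theorem proj_apply_of_mem (ψ : H4) {k : ℕ+ × ℕ+} (h : S.I k) : S.proj ψ k = ψ k := by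
  simp [proj, h]

theorem proj_apply_of_not_mem (ψ : H4) {k : ℕ+ × ℕ+} (h : ¬ S.I k) : S.proj ψ k = 0 := by
  simp [proj, h]

theorem proj_eq_self {ψ : H4} (h : ∀ k, ¬ S.I k → ψ k = 0) : S.proj ψ = ψ := by
  ext k
  by_cases hk : S.I k
  · exact S.proj_apply_of_mem ψ hk
  · rw [S.proj_apply_of_not_mem ψ hk, h k hk]

theorem apply_eq_zero {ψ : H4} (h : S.proj ψ = ψ) {k : ℕ+ × ℕ+} (hk : ¬ S.I k) : ψ k = 0 := by
  rw [← h, S.proj_apply_of_not_mem ψ hk]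

theorem proj_proj (ψ : H4) : S.proj (S.proj ψ) = S.proj ψ :=
  S.proj_eq_self fun _ hk => S.proj_apply_of_not_mem ψ hk

theorem proj_diag (f : ℕ+ × ℕ+ → ℝ) (h : ∃ C, ∀ k, |f k| ≤ C) (ψ : H4) :
    S.proj (diag f h ψ) = diag f h (S.proj ψ) := by
  ext k
  rw [diag_apply]
  by_cases hk : S.I k
  · rw [S.proj_apply_of_mem _ hk, S.proj_apply_of_mem _ hk, diag_apply]
  · rw [S.proj_apply_of_not_mem _ hk, S.proj_apply_of_not_mem _ hk, mul_zero]

theorem proj_single_of_mem {k : ℕ+ × ℕ+} (h : S.I k) (r : ℝ) :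
    S.proj (lp.single 2 k r) = lp.single 2 k r := by
  rw [proj, diag_single]; simp [h]

theorem proj_single_of_not_mem {k : ℕ+ × ℕ+} (h : ¬ S.I k) (r : ℝ) :
    S.proj (lp.single 2 k r) = 0 := by
  rw [proj, diag_single]; simp [h]

theorem proj_base : S.proj base = base := by
  rw [base, map_smul, S.proj_single_of_mem S.mem_base]

theorem isClosed_fixed : IsClosed ((S.proj - ContinuousLinearMap.id ℝ H4).ker : Set H4) :=
  (S.proj - ContinuousLinearMap.id ℝ H4).isClosed_ker

theorem mem_fixed {ψ : H4} : ψ ∈ (S.proj - ContinuousLinearMap.id ℝ H4).ker ↔ S.proj ψ = ψ := by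
  rw [LinearMap.mem_ker]
  exact sub_eq_zero

/-- Closure of the class under the Jacobian is known for pairs of modes; it extends to series one
argument at a time, the fixed space of `proj` being closed. -/
theorem proj_jacC {φ v : H4} (hφ : S.proj φ = φ) (hv : S.proj v = v) :
    S.proj (jacC φ v) = jacC φ v := by
  have h1 : ∀ k l, S.proj (jacC (S.proj (lp.single 2 k 1)) (S.proj (lp.single 2 l 1))) =
      jacC (S.proj (lp.single 2 k 1)) (S.proj (lp.single 2 l 1)) := fun k l => by
    by_cases hk : S.I k
    · by_cases hl : S.I l
      · rw [S.proj_single_of_mem hk, S.proj_single_of_mem hl]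
        refine S.proj_eq_self fun q hq => ?_
        rw [jacC_single_apply, S.coupling_eq_zero k l q hk hl hq, mul_zero]
      · rw [S.proj_single_of_not_mem hl]; simp
    · rw [S.proj_single_of_not_mem hk]; simp
  have h2 : ∀ k, S.proj (jacC (S.proj (lp.single 2 k 1)) v) =
      jacC (S.proj (lp.single 2 k 1)) v := fun k => by
    have := mem_of_apply_single (f := (jacC (S.proj (lp.single 2 k 1))).comp S.proj)
      S.isClosed_fixed (fun l => S.mem_fixed.2 (h1 k l)) v
    rw [ContinuousLinearMap.comp_apply, hv] at this
    exact S.mem_fixed.1 this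
  have := mem_of_apply_single (f := (jacC.flip v).comp S.proj)
      S.isClosed_fixed (fun k => S.mem_fixed.2 (h2 k)) φ
  rw [ContinuousLinearMap.comp_apply, hφ] at this
  exact S.mem_fixed.1 this

theorem proj_twoAddLap (ψ : H4) : S.proj (twoAddLap ψ) = twoAddLap (S.proj ψ) := by
  simp only [twoAddLap, _root_.add_apply, _root_.smul_apply, map_add, map_smul, incl, lap, proj_diag]

theorem proj_advect {ψ : H4} (h : S.proj ψ = ψ) : S.proj (advect ψ) = advect ψ := by
  rw [advect, ContinuousLinearMap.comp_apply]
  exact S.proj_jacC S.proj_base (by rw [proj_twoAddLap, h])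

theorem abs_s_le (k : ℕ+ × ℕ+) : |S.s k| ≤ 1 := by
  rw [← sq_le_one_iff_abs_le_one, S.s_sq]

/-- The signed permutation. -/
noncomputable def T : H4 →L[ℝ] H4 := (diag S.s ⟨1, S.abs_s_le⟩).comp (permOp S.π)

theorem T_apply (ψ : H4) (k : ℕ+ × ℕ+) : S.T ψ k = S.s k * ψ (S.π k) := by
  rw [T, ContinuousLinearMap.comp_apply, diag_apply, permOp_apply]

theorem T_single (l : ℕ+ × ℕ+) : S.T (lp.single 2 l 1) = S.s l • lp.single 2 (S.π l) (1 : ℝ) := by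
  ext k
  rw [T_apply, lp.coeFn_smul, Pi.smul_apply, smul_eq_mul]
  by_cases h : k = S.π l
  · subst h; rw [S.π_π, S.s_π]; simp
  · have h' : S.π k ≠ l := fun hh => h (by rw [← hh, S.π_π])
    simp [h, h']

theorem advect_T {ψ : H4} (h : S.proj ψ = ψ) : advect (S.T ψ) = -S.T (advect ψ) := by
  have : advect.comp (S.T.comp S.proj) = -(S.T.comp (advect.comp S.proj)) := by
    refine eq_of_apply_single fun l => ?_
    simp only [ContinuousLinearMap.comp_apply, _root_.neg_apply]
    by_cases hl : S.I l
    · rw [S.proj_single_of_mem hl, T_single, map_smul]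
      ext q
      simp only [lp.coeFn_smul, lp.coeFn_neg, Pi.smul_apply, Pi.neg_apply, smul_eq_mul, T_apply,
        advect_single_apply, S.beta_π]
      linear_combination (1 / Real.pi ^ 2 * ((2 - beta l) / (1 + beta l ^ 2))) * S.anticomm l q hl
    · rw [S.proj_single_of_not_mem hl]; simp
  have h2 := congrArg (fun T : H4 →L[ℝ] H4 => T ψ) this
  simp only [ContinuousLinearMap.comp_apply, _root_.neg_apply, h] at h2
  exact h2

theorem T_viscous (ν μ : ℝ) (ψ : H4) : S.T (viscous ν μ ψ) = viscous ν μ (S.T ψ) := by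
  ext k
  rw [T_apply, viscous, diag_apply, diag_apply, T_apply, S.beta_π]
  ring

/-- The quadratic form `⟨-μ Δφ + ν Δ²φ, (2 + Δ) φ⟩` is nonpositive on the functions of the class
without the mode `k₀`. -/
theorem eq_zero_of_inner_nonneg {ν μ : ℝ} (hν : 0 < ν) (hμ : 0 ≤ μ) {φ : H4} (hφ : S.proj φ = φ)
    (h0 : φ S.k₀ = 0) (hq : 0 ≤ ⟪viscous ν μ φ, cfTwoAddLap φ⟫) :
    ∀ k, k ≠ (2, 2) → φ k = 0 := by
  have hs := lp.hasSum_inner (𝕜 := ℝ) (viscous ν μ φ) (cfTwoAddLap φ)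
  have hterm : ∀ k, ⟪viscous ν μ φ k, cfTwoAddLap φ k⟫ =
      -((μ * beta k + ν * beta k ^ 2) * (beta k - 2) / (1 + beta k ^ 2) ^ 2 * φ k ^ 2) := fun k => by
    rw [viscous, cfTwoAddLap, diag_apply, diag_apply]
    simp only [RCLike.inner_apply, conj_trivial]
    have := (one_add_beta_sq_pos k).ne'
    field_simp
    ring
  simp only [hterm] at hs
  -- The mode `k₀` is absent by `h0`, the factor `β - 2` vanishes at `(2, 2)`, and the remaining
  -- modes of the class have `β > 2`.
  have hnn : ∀ k, 0 ≤ (μ * beta k + ν * beta k ^ 2) * (beta k - 2) / (1 + beta k ^ 2) ^ 2 *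
      φ k ^ 2 := fun k => by
    by_cases hk : S.I k
    · by_cases hk0 : k = S.k₀
      · rw [hk0, h0]; simp
      · by_cases hk2 : k = (2, 2)
        · rw [hk2, beta_two_two]; simp
        · have h1 := viscous_pos hν hμ k
          have h2 : 0 < beta k - 2 := sub_pos.2 (S.two_lt_beta k hk hk0 hk2)
          positivity
    · rw [S.apply_eq_zero hφ hk]; simp
  have hs' := hs.neg
  simp only [neg_neg] at hs'
  have h0' : -⟪viscous ν μ φ, cfTwoAddLap φ⟫ = 0 :=
    le_antisymm (by linarith) (hs'.nonneg hnn)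
  rw [h0', hasSum_zero_iff_of_nonneg hnn] at hs'
  intro k hk2
  by_cases hk : S.I k
  · by_cases hk0 : k = S.k₀
    · rw [hk0, h0]
    · have h1 := viscous_pos hν hμ k
      have h2 : 0 < beta k - 2 := sub_pos.2 (S.two_lt_beta k hk hk0 hk2)
      have h3 := congrFun hs' k
      simp only [Pi.zero_apply, mul_eq_zero, div_eq_zero_iff, pow_eq_zero_iff, ne_eq,
        OfNat.ofNat_ne_zero, not_false_eq_true] at h3
      have h4 := one_add_beta_sq_pos k
      rcases h3 with ((h3 | h3) | h3) | h3
      · exact absurd h3 h1.ne'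
      · exact absurd h3 h2.ne'
      · exact absurd h3 h4.ne'
      · exact h3
  · exact S.apply_eq_zero hφ hk

/-- Only a multiple of `ψ₀` remains, and `2 + Δ` annihilates it. -/
theorem advect_eq_zero {φ : H4} (h : ∀ k, k ≠ (2, 2) → φ k = 0) : advect φ = 0 := by
  have : twoAddLap φ = 0 := by
    ext k
    simp only [twoAddLap, _root_.add_apply, _root_.smul_apply, lp.coeFn_add, lp.coeFn_smul,
      Pi.add_apply, Pi.smul_apply, incl, lap, diag_apply, smul_eq_mul, lp.coeFn_zero,
      Pi.zero_apply]
    by_cases hk : k = (2, 2)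
    · rw [hk, beta_two_two]; ring
    · rw [h k hk]; ring
  rw [advect, ContinuousLinearMap.comp_apply, this, map_zero]

/-- A function of the class in the kernel of the linearisation is determined by its `k₀` mode. -/
theorem eq_zero_of_kernel {ν μ : ℝ} (hν : 0 < ν) (hμ : 0 ≤ μ) {φ : H4} (hφ : S.proj φ = φ)
    (h0 : φ S.k₀ = 0) (hk : viscous ν μ φ + advect φ = 0) : φ = 0 := by
  have h1 : ⟪advect φ, cfTwoAddLap φ⟫ = 0 := by linarith [inner_advect_antisymm φ φ]
  have h2 : ⟪viscous ν μ φ, cfTwoAddLap φ⟫ = 0 := by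
    have := congrArg (fun x => ⟪x, cfTwoAddLap φ⟫) hk
    simp only [inner_add_left, inner_zero_left, h1, add_zero] at this
    exact this
  have h3 := S.eq_zero_of_inner_nonneg hν hμ hφ h0 h2.ge
  rw [advect_eq_zero h3, add_zero] at hk
  exact eq_zero_of_viscous_eq_zero hν hμ hk

/-! ### Simplicity of the kernel and transversality -/

section Critical

variable {ν μ : ℝ} {ψ : H4}

theorem inner_viscous_comm (φ χ : H4) :
    ⟪viscous ν μ φ, cfTwoAddLap χ⟫ = ⟪viscous ν μ χ, cfTwoAddLap φ⟫ := by
  rw [lp.inner_eq_tsum, lp.inner_eq_tsum]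
  refine tsum_congr fun k => ?_
  simp only [viscous, cfTwoAddLap, diag_apply, RCLike.inner_apply, conj_trivial]
  ring

/-- The permutation preserves `β`, and the signs have square one. -/
theorem inner_viscous_T (φ : H4) :
    ⟪viscous ν μ (S.T φ), cfTwoAddLap (S.T φ)⟫ = ⟪viscous ν μ φ, cfTwoAddLap φ⟫ := by
  rw [lp.inner_eq_tsum, lp.inner_eq_tsum, ← S.π.tsum_eq]
  refine tsum_congr fun k => ?_
  simp only [viscous, cfTwoAddLap, diag_apply, RCLike.inner_apply, conj_trivial, T_apply, S.beta_π,
    S.π_π, S.s_π]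
  have := S.s_sq k
  linear_combination ((2 - beta k) / (1 + beta k ^ 2) * φ k *
    ((μ * beta k + ν * beta k ^ 2) / (1 + beta k ^ 2) * φ k)) * this

/-- The transversality condition. -/
theorem inner_viscous_T_ne_zero (hν : 0 < ν) (hμ : 0 ≤ μ) (hψ : ψ ≠ 0) (hP : S.proj ψ = ψ)
    (h22 : ψ (2, 2) = 0) (hk : viscous ν μ ψ + advect ψ = 0) :
    ⟪viscous ν μ ψ, cfTwoAddLap (S.T ψ)⟫ ≠ 0 := by
  intro h
  have h1 : ⟪advect ψ, cfTwoAddLap ψ⟫ = 0 := by linarith [inner_advect_antisymm ψ ψ]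
  have h2 : ⟪viscous ν μ ψ, cfTwoAddLap ψ⟫ = 0 := by
    have := congrArg (fun x => ⟪x, cfTwoAddLap ψ⟫) hk
    simp only [inner_add_left, inner_zero_left, h1, add_zero] at this
    exact this
  -- In the expansion of the quadratic form all four terms vanish: the diagonal ones by `h2` and
  -- invariance under `T`, the mixed ones by `h` and symmetry.
  have h3 : ⟪viscous ν μ (ψ - S.T ψ), cfTwoAddLap (ψ - S.T ψ)⟫ = 0 := by
    simp only [map_sub, inner_sub_left, inner_sub_right]
    rw [S.inner_viscous_T, inner_viscous_comm (S.T ψ) ψ, h, h2]; ring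
  have hsub : ∀ k, (ψ - S.T ψ) k = ψ k - S.s k * ψ (S.π k) := fun k => by
    rw [lp.coeFn_sub, Pi.sub_apply, T_apply]
  have h4 : S.proj (ψ - S.T ψ) = ψ - S.T ψ := S.proj_eq_self fun k hk => by
    rw [hsub, S.apply_eq_zero hP hk, S.apply_eq_zero hP (mt (S.mem_π k).1 hk)]; simp
  have h5 := S.eq_zero_of_inner_nonneg hν hμ h4 (by rw [hsub, S.π_k₀, S.s_k₀]; ring) h3.ge
  have h6 : S.T ψ = ψ := by
    ext k
    have : (ψ - S.T ψ) k = 0 := by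
      -- The form does not control the mode `(2, 2)`; there `h22` is used.
      by_cases hk2 : k = (2, 2)
      · rw [hsub, hk2, S.π_base, h22]; simp
      · exact h5 k hk2
    rw [lp.coeFn_sub, Pi.sub_apply] at this
    linarith
  -- Once `Tψ = ψ`, anticommutation and the kernel equation give `-Aψ = Aψ`, where `A` is the
  -- viscous operator.
  have h7 := S.advect_T hP
  rw [h6, eq_neg_of_add_eq_zero_right hk, map_neg, S.T_viscous, h6, neg_neg] at h7
  have h8 : viscous ν μ ψ = 0 := by
    have : (2 : ℝ) • viscous ν μ ψ = 0 := by
      rw [two_smul]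
      nth_rewrite 1 [← h7]
      simp
    simpa using this
  exact hψ (eq_zero_of_viscous_eq_zero hν hμ h8)

/-- Pairing the equation with `(2 + Δ)Tψ` removes the terms in `Ψ`, because `Tψ` solves the equation
with reversed advection; transversality then forces `κ = 0`. What remains is a kernel element, and
subtracting the multiple of `ψ` with the same `k₀` coefficient gives zero. -/
theorem kernel_and_transversality (hν : 0 < ν) (hμ : 0 ≤ μ) (hψ : ψ ≠ 0) (hP : S.proj ψ = ψ)
    (h22 : ψ (2, 2) = 0) (hk : viscous ν μ ψ + advect ψ = 0) {Ψ : H4} {κ : ℝ}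
    (hΨ : S.proj Ψ = Ψ) (h : viscous ν μ Ψ + advect Ψ + κ • viscous ν μ ψ = 0) :
    κ = 0 ∧ ∃ r : ℝ, Ψ = r • ψ := by
  have hadv : advect (S.T ψ) = viscous ν μ (S.T ψ) := by
    rw [S.advect_T hP, eq_neg_of_add_eq_zero_right hk, map_neg, S.T_viscous, neg_neg]
  have h1 : ⟪advect Ψ, cfTwoAddLap (S.T ψ)⟫ = -⟪viscous ν μ Ψ, cfTwoAddLap (S.T ψ)⟫ := by
    rw [inner_advect_antisymm, hadv, inner_viscous_comm]
  have h2 := congrArg (fun x => ⟪x, cfTwoAddLap (S.T ψ)⟫) h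
  simp only [inner_add_left, inner_zero_left, h1, inner_smul_left, conj_trivial] at h2
  have hκ : κ = 0 := by
    have h3 : κ * ⟪viscous ν μ ψ, cfTwoAddLap (S.T ψ)⟫ = 0 := by linarith
    exact (mul_eq_zero.1 h3).resolve_right (S.inner_viscous_T_ne_zero hν hμ hψ hP h22 hk)
  refine ⟨hκ, Ψ S.k₀ / ψ S.k₀, ?_⟩
  rw [hκ, zero_smul, add_zero] at h
  have hψ0 : ψ S.k₀ ≠ 0 := fun h0 => hψ (S.eq_zero_of_kernel hν hμ hP h0 hk)
  rw [← sub_eq_zero]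
  refine S.eq_zero_of_kernel hν hμ ?_ ?_ ?_
  · rw [map_sub, map_smul, hΨ, hP]
  · rw [lp.coeFn_sub, Pi.sub_apply, lp.coeFn_smul, Pi.smul_apply, smul_eq_mul]
    field_simp
    ring
  · have : viscous ν μ (Ψ - (Ψ S.k₀ / ψ S.k₀) • ψ) + advect (Ψ - (Ψ S.k₀ / ψ S.k₀) • ψ) =
        (viscous ν μ Ψ + advect Ψ) - (Ψ S.k₀ / ψ S.k₀) • (viscous ν μ ψ + advect ψ) := by
      simp only [map_sub, map_smul]
      module
    rw [this, h, hk, smul_zero, sub_zero]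

end Critical

end FlowSymmetry

/-! ### The three parity classes -/

theorem tri_eq_zero {a b c : ℤ} (h : Odd (a + b + c)) : tri a b c = 0 := perInt_cn_sn_sn_eq_zero h

theorem coupling_eq_zero_of_odd {k l q : ℕ+ × ℕ+}
    (h : Odd ((k.1 : ℕ) + (l.1 : ℕ) + (q.1 : ℕ)) ∨ Odd ((k.2 : ℕ) + (l.2 : ℕ) + (q.2 : ℕ))) :
    coupling k l q = 0 := by
  rcases h with h | h
  · have h1 : tri (k.1 : ℕ) (l.1 : ℕ) (q.1 : ℕ) = 0 := tri_eq_zero (by exact_mod_cast h)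
    have h2 : tri (l.1 : ℕ) (k.1 : ℕ) (q.1 : ℕ) = 0 :=
      tri_eq_zero (by rw [add_comm (((l.1 : ℕ)) : ℤ)]; exact_mod_cast h)
    rw [coupling, h1, h2]; ring
  · have h1 : tri (k.2 : ℕ) (l.2 : ℕ) (q.2 : ℕ) = 0 := tri_eq_zero (by exact_mod_cast h)
    have h2 : tri (l.2 : ℕ) (k.2 : ℕ) (q.2 : ℕ) = 0 :=
      tri_eq_zero (by rw [add_comm (((l.2 : ℕ)) : ℤ)]; exact_mod_cast h)
    rw [coupling, h1, h2]; ring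

/-- With `b = 2b'` and `c = 2c'`, divisibility of `b + c` by four makes `1 + b' + c'` odd, so
translation by `π` changes the sign of the integrand. -/
theorem tri_two_eq_zero {b c : ℕ} (hb : Even b) (h : (b + c) % 4 = 0) :
    tri (2 : ℕ) b c = 0 ∧ tri b (2 : ℕ) c = 0 := by
  have hc : Even c := by
    rw [Nat.even_iff] at hb ⊢; omega
  obtain ⟨b', rfl⟩ := hb
  obtain ⟨c', rfl⟩ := hc
  have e : ∀ d : ℕ, ((d + d : ℕ) : ℤ) = 2 * (d : ℤ) := fun d => by push_cast; ring
  have e2 : ((2 : ℕ) : ℤ) = 2 * 1 := rfl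
  have hodd : Odd (1 + (b' : ℤ) + c') := by
    rw [Int.odd_iff]; omega
  rw [e, e, e2]
  exact ⟨perInt_even_eq_zero hodd, perInt_even_eq_zero (by rw [add_comm (b' : ℤ)]; exact hodd)⟩

theorem sign_add_sign_eq_zero {b c : ℕ} (hb : Even b) (hc : Even c) (h : (b + c) % 4 ≠ 0) :
    (if 4 ∣ b then (-1 : ℝ) else 1) + (if 4 ∣ c then (-1 : ℝ) else 1) = 0 := by
  rw [Nat.even_iff] at hb hc
  by_cases h1 : 4 ∣ b
  · have h2 : ¬ 4 ∣ c := by omega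
    simp [h1, h2]
  · have h2 : 4 ∣ c := by omega
    simp [h1, h2]

theorem two_lt_beta_of {k : ℕ+ × ℕ+}
    (h : ¬ ((k.1 : ℕ) ≤ 2 ∧ (k.2 : ℕ) ≤ 2)) : 2 < beta k := by
  have h1 := one_le_natCast_pnat k.1
  have h2 := one_le_natCast_pnat k.2
  have h3 : (3 : ℝ) ≤ ((k.1 : ℕ) : ℝ) ∨ (3 : ℝ) ≤ ((k.2 : ℕ) : ℝ) := by
    by_contra hh
    push Not at hh
    refine h ⟨?_, ?_⟩
    · have : (k.1 : ℕ) < 3 := by exact_mod_cast hh.1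
      omega
    · have : (k.2 : ℕ) < 3 := by exact_mod_cast hh.2
      omega
  unfold beta
  rcases h3 with h3 | h3 <;> nlinarith

theorem eq_of_natCast_eq {k : ℕ+ × ℕ+} {n m : ℕ+} (h1 : (k.1 : ℕ) = n) (h2 : (k.2 : ℕ) = m) :
    k = (n, m) := Prod.ext (PNat.coe_injective h1) (PNat.coe_injective h2)

/-- The class `n + m` even, with the exchange of `x` and `y`. -/
noncomputable def symmOddOdd : FlowSymmetry where
  -- The Jacobian of two odd-odd modes has even-even modes, so the class consists of both kinds.
  I k := Even ((k.1 : ℕ) + (k.2 : ℕ))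
  π := Equiv.prodComm _ _
  s _ := 1
  k₀ := (1, 1)
  coupling_eq_zero k l q hk hl hq := by
    apply coupling_eq_zero_of_odd
    rw [Nat.even_iff] at hk hl hq
    rw [Nat.odd_iff, Nat.odd_iff]
    omega
  mem_base := by decide
  π_π k := rfl
  s_sq k := by norm_num
  s_π k := rfl
  mem_π k := by simp [add_comm]
  beta_π k := beta_swap k
  π_k₀ := rfl
  s_k₀ := rfl
  π_base := rfl
  -- Exchanging `x` and `y` fixes `ψ₀` and changes the sign of the Jacobian.
  anticomm l q _ := by
    simp only [coupling, Equiv.prodComm_apply, Prod.fst_swap, Prod.snd_swap]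
    ring
  two_lt_beta k hk h1 h2 := by
    refine two_lt_beta_of fun h => ?_
    have p1 := k.1.pos
    have p2 := k.2.pos
    rw [Nat.even_iff] at hk
    rcases Nat.lt_or_ge (k.1 : ℕ) 2 with h3 | h3
    · exact h1 (eq_of_natCast_eq (by change (k.1 : ℕ) = 1; omega) (by change (k.2 : ℕ) = 1; omega))
    · exact h2 (eq_of_natCast_eq (by change (k.1 : ℕ) = 2; omega) (by change (k.2 : ℕ) = 2; omega))

/-- The class `m` even, with the sign of the translation by `π` in `y`. -/
noncomputable def symmOddEven : FlowSymmetry where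
  I k := Even (k.2 : ℕ)
  π := Equiv.refl _
  -- On even `m` this is minus the sign `(-1)^(m/2)` of the translation by `π` in `y`, which sends
  -- `ψ₀` to `-ψ₀`. The extra minus sign leaves anticommutation intact and gives `s k₀ = 1` at `m =
  -- 2`.
  s k := if 4 ∣ (k.2 : ℕ) then -1 else 1
  k₀ := (1, 2)
  coupling_eq_zero k l q hk hl hq := by
    apply coupling_eq_zero_of_odd
    rw [Nat.even_iff] at hk hl hq
    rw [Nat.odd_iff, Nat.odd_iff]
    omega
  mem_base := by decide
  π_π k := rfl
  s_sq k := by split_ifs <;> norm_num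
  s_π k := rfl
  mem_π k := Iff.rfl
  beta_π k := rfl
  π_k₀ := rfl
  s_k₀ := by norm_num
  π_base := rfl
  anticomm l q hl := by
    simp only [Equiv.refl_apply]
    -- If four divides the sum, the coupling vanishes. Otherwise, for even frequencies, exactly one
    -- is divisible by four and the two signs are opposite.
    by_cases h4 : ((l.2 : ℕ) + (q.2 : ℕ)) % 4 = 0
    · have := tri_two_eq_zero hl h4
      have h0 : coupling (2, 2) l q = 0 := by
        rw [coupling]
        change _ * (_ * tri _ (2 : ℕ) _) - _ * (_ * tri (2 : ℕ) _ _) = _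
        rw [this.1, this.2]; ring
      rw [h0]; ring
    · rcases Nat.even_or_odd (q.2 : ℕ) with hq | hq
      · linear_combination coupling (2, 2) l q * sign_add_sign_eq_zero hl hq h4
      · have h0 : coupling (2, 2) l q = 0 := by
          apply coupling_eq_zero_of_odd
          right
          change Odd (2 + _ + _)
          rw [Nat.even_iff] at hl
          rw [Nat.odd_iff] at hq ⊢
          omega
        rw [h0]; ring
  two_lt_beta k hk h1 h2 := by
    refine two_lt_beta_of fun h => ?_
    have p1 := k.1.pos
    have p2 := k.2.pos
    rw [Nat.even_iff] at hk
    rcases Nat.lt_or_ge (k.1 : ℕ) 2 with h3 | h3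
    · exact h1 (eq_of_natCast_eq (by change (k.1 : ℕ) = 1; omega) (by change (k.2 : ℕ) = 2; omega))
    · exact h2 (eq_of_natCast_eq (by change (k.1 : ℕ) = 2; omega) (by change (k.2 : ℕ) = 2; omega))

/-- The class `n` even, with the sign of the translation by `π` in `x`. -/
noncomputable def symmEvenOdd : FlowSymmetry where
  I k := Even (k.1 : ℕ)
  π := Equiv.refl _
  -- As before with the variables exchanged: minus the sign of the translation by `π` in `x`,
  -- normalised at `n = 2`.
  s k := if 4 ∣ (k.1 : ℕ) then -1 else 1
  k₀ := (2, 1)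
  coupling_eq_zero k l q hk hl hq := by
    apply coupling_eq_zero_of_odd
    rw [Nat.even_iff] at hk hl hq
    rw [Nat.odd_iff, Nat.odd_iff]
    omega
  mem_base := by decide
  π_π k := rfl
  s_sq k := by split_ifs <;> norm_num
  s_π k := rfl
  mem_π k := Iff.rfl
  beta_π k := rfl
  π_k₀ := rfl
  s_k₀ := by norm_num
  π_base := rfl
  anticomm l q hl := by
    simp only [Equiv.refl_apply]
    by_cases h4 : ((l.1 : ℕ) + (q.1 : ℕ)) % 4 = 0
    · have := tri_two_eq_zero hl h4
      have h0 : coupling (2, 2) l q = 0 := by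
        rw [coupling]
        change _ * (tri (2 : ℕ) _ _ * _) - _ * (tri _ (2 : ℕ) _ * _) = _
        rw [this.1, this.2]; ring
      rw [h0]; ring
    · rcases Nat.even_or_odd (q.1 : ℕ) with hq | hq
      · linear_combination coupling (2, 2) l q * sign_add_sign_eq_zero hl hq h4
      · have h0 : coupling (2, 2) l q = 0 := by
          apply coupling_eq_zero_of_odd
          left
          change Odd (2 + _ + _)
          rw [Nat.even_iff] at hl
          rw [Nat.odd_iff] at hq ⊢
          omega
        rw [h0]; ring
  two_lt_beta k hk h1 h2 := by
    refine two_lt_beta_of fun h => ?_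
    have p1 := k.1.pos
    have p2 := k.2.pos
    rw [Nat.even_iff] at hk
    rcases Nat.lt_or_ge (k.2 : ℕ) 2 with h3 | h3
    · exact h1 (eq_of_natCast_eq (by change (k.1 : ℕ) = 2; omega) (by change (k.2 : ℕ) = 1; omega))
    · exact h2 (eq_of_natCast_eq (by change (k.1 : ℕ) = 2; omega) (by change (k.2 : ℕ) = 2; omega))

theorem apply_eq_zero_of_coeff {ψ : H4} {k : ℕ+ × ℕ+} (h : coeff ψ k = 0) : ψ k = 0 := by
  rw [coeff, div_eq_zero_iff] at h
  exact h.resolve_right (one_add_beta_sq_pos k).ne'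

/-- Each class contains one of the spaces `E1`, `E2`, `E3`. The mode `(2, 2)` is even-even and so
belongs to none of these spaces. -/
theorem exists_flowSymmetry {ψ : H4} (hE : ψ ∈ E1 ∨ ψ ∈ E2 ∨ ψ ∈ E3) :
    ∃ S : FlowSymmetry, S.proj ψ = ψ ∧ ψ (2, 2) = 0 := by
  have h2 : ¬ Odd ((2 : ℕ+) : ℕ) := by decide
  rcases hE with h | h | h
  · refine ⟨symmOddOdd, symmOddOdd.proj_eq_self fun k hk => apply_eq_zero_of_coeff (h k fun hh =>
      hk (hh.1.add_odd hh.2)), apply_eq_zero_of_coeff (h _ fun hh => h2 hh.1)⟩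
  · refine ⟨symmOddEven, symmOddEven.proj_eq_self fun k hk => apply_eq_zero_of_coeff (h k fun hh =>
      hk hh.2), apply_eq_zero_of_coeff (h _ fun hh => h2 hh.1)⟩
  · refine ⟨symmEvenOdd, symmEvenOdd.proj_eq_self fun k hk => apply_eq_zero_of_coeff (h k fun hh =>
      hk hh.1), apply_eq_zero_of_coeff (h _ fun hh => h2 hh.2)⟩

/-! ### The spectral problem and the steady flow problem in terms of coefficients -/

theorem bound_bilap : ∃ C, ∀ k : ℕ+ × ℕ+, |beta k ^ 2 / (1 + beta k ^ 2)| ≤ C :=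
  ⟨1, fun k => by
    rw [abs_of_nonneg (by positivity), div_le_one (one_add_beta_sq_pos k)]
    linarith⟩

/-- The coefficients of `Δ²ψ`. -/
noncomputable def cfbl : H4 →L[ℝ] H4 := diag _ bound_bilap

theorem viscous_eq (ν μ : ℝ) (ψ : H4) : viscous ν μ ψ = -μ • cfl ψ + ν • cfbl ψ := by
  ext k
  simp only [viscous, cfbl, lp.coeFn_add, lp.coeFn_smul, Pi.add_apply, Pi.smul_apply, diag_apply,
    smul_eq_mul, wl]
  ring

theorem hasWeakLaplacian_toBCF {f : ℝ × ℝ → ℝ} {ψ : H4} (hf : f =ᵐ[volume.restrict Ω] toBCF ψ) :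
    HasWeakLaplacian f (synS (cfl ψ)) :=
  hasWeakLaplacian_synS (c := cf0 ψ)
    (fun k => by simp only [diag_apply, wl, w0]; ring) (hf.trans (toBCF_ae ψ))

theorem hasWeakLaplacian_cfl {f : ℝ × ℝ → ℝ} {ψ : H4} (hf : f =ᵐ[volume.restrict Ω] synS (cfl ψ)) :
    HasWeakLaplacian f (synS (cfbl ψ)) :=
  hasWeakLaplacian_synS (fun k => by simp only [cfbl, diag_apply, wl]; ring) hf

theorem synS_injective : Function.Injective synS :=
  Function.LeftInverse.injective (analysis_synth isModeFamily_ssM)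

/-- Injectivity of the sine synthesis turns an almost-everywhere identity into one between
coefficient families. -/
theorem synS_add_eq_zero_iff {ν μ : ℝ} {ψ c : H4} :
    (∀ᵐ p ∂volume.restrict Ω, synS c p + (-μ * synS (cfl ψ) p + ν * synS (cfbl ψ) p) = 0) ↔
      viscous ν μ ψ + c = 0 := by
  have h1 : synS (viscous ν μ ψ + c) =ᵐ[volume.restrict Ω]
      fun p => synS c p + (-μ * synS (cfl ψ) p + ν * synS (cfbl ψ) p) := by
    rw [viscous_eq, map_add, map_add, map_smul, map_smul]
    filter_upwards [Lp.coeFn_add (-μ • synS (cfl ψ) + ν • synS (cfbl ψ)) (synS c),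
      Lp.coeFn_add (-μ • synS (cfl ψ)) (ν • synS (cfbl ψ)), Lp.coeFn_smul (-μ) (synS (cfl ψ)),
      Lp.coeFn_smul ν (synS (cfbl ψ))] with p a b c d
    rw [a, Pi.add_apply, b, Pi.add_apply, c, d]
    simp only [Pi.smul_apply, smul_eq_mul]
    ring
  rw [← map_eq_zero_iff synS synS_injective, Lp.eq_zero_iff_ae_eq_zero]
  constructor
  · intro h
    filter_upwards [h, h1] with p a b
    rw [b, a]; rfl
  · intro h
    filter_upwards [h, h1] with p a b
    rw [← b, a]; rfl

theorem vorS_twoAddLap_ae (ψ : H4) : vorS (twoAddLap ψ) =ᵐ[volume.restrict Ω]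
    fun p => 2 * toBCF ψ p + synS (cfl ψ) p := by
  rw [twoAddLap, _root_.add_apply, _root_.smul_apply, map_add, map_smul, vorS_incl, vorS_lap]
  filter_upwards [Lp.coeFn_add ((2 : ℝ) • synS (cf0 ψ)) (synS (cfl ψ)),
    Lp.coeFn_smul (2 : ℝ) (synS (cf0 ψ)), toBCF_ae ψ] with p a b c
  rw [a, Pi.add_apply, b, c]; rfl

/-- Weak Laplacians and Jacobians are unique almost everywhere, so those supplied by the hypothesis
agree with the ones given by the series. -/
theorem IsSpectralSolution.viscous_add_advect {ψ : H4} {ν μ : ℝ} (h : IsSpectralSolution 0 ψ ν μ) :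
    viscous ν μ ψ + advect ψ = 0 := by
  obtain ⟨-, w, b, j, hw, hb, hj, heq⟩ := h
  have hf : toFun ψ =ᵐ[volume.restrict Ω] toBCF ψ :=
    Eventually.of_forall fun p => (toBCF_apply ψ p).symm
  have h1 := hw.ae_unique (hasWeakLaplacian_toBCF hf) ae_eq_rfl
  have h2 := hb.ae_unique (hasWeakLaplacian_cfl h1) ae_eq_rfl
  have hb0 : psi0 =ᵐ[volume.restrict Ω] toBCF base :=
    Eventually.of_forall fun p => (toBCF_base p).symm
  have hv : (fun p => 2 * toFun ψ p + w p) =ᵐ[volume.restrict Ω] vorS (twoAddLap ψ) := by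
    filter_upwards [hf, h1, vorS_twoAddLap_ae ψ] with p a b c
    rw [c, a, b]
  have h3 : j =ᵐ[volume.restrict Ω] jac base (twoAddLap ψ) :=
    hj.ae_unique (hasJacobian_jac hb0 hv) ae_eq_rfl ae_eq_rfl
  rw [← synS_add_eq_zero_iff]
  have h4 : synS (advect ψ) = jac base (twoAddLap ψ) := by
    rw [advect, ContinuousLinearMap.comp_apply, synS_jacC]
  rw [h4]
  filter_upwards [heq, h1, h2, h3] with p a b c d
  rw [← b, ← c, ← d]
  linarith

theorem lap_base : lap base = -(2 : ℝ) • incl base := by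
  simp only [base, map_smul, lap, incl, diag_single, beta_two_two]
  rw [← lp.single_smul, ← lp.single_smul, ← lp.single_smul]
  congr 1
  norm_num

/-- Since `Δψ₀ = -2ψ₀`, the pure basic term is a multiple of `J(ψ₀, ψ₀) = 0`, and `J(θ, Δψ₀) =
2J(ψ₀, θ)` joins `J(ψ₀, Δθ)` to form the advection term. -/
theorem jacC_base_add (θ : H4) :
    jacC (base + θ) (lap (base + θ)) = advect θ + jacC θ (lap θ) := by
  have h1 : jacC base (incl base) = 0 := by
    have := jacC_incl_antisymm base base
    have h2 : (2 : ℝ) • jacC base (incl base) = 0 := by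
      rw [two_smul]
      nth_rewrite 1 [this]
      exact neg_add_cancel _
    exact (smul_eq_zero.1 h2).resolve_left two_ne_zero
  have h2 := jacC_incl_antisymm θ base
  rw [advect, ContinuousLinearMap.comp_apply, twoAddLap]
  simp only [map_add, _root_.add_apply, _root_.smul_apply, lap_base, map_smul, h1, h2]
  module

theorem sn_eq_zero_of_mem_frontier {x : ℝ} (hx : x ∈ frontier (Ioo 0 (2 * Real.pi))) (j : ℤ) :
    sn j x = 0 := by
  rw [frontier_Ioo (by positivity)] at hx
  rcases hx with rfl | hx
  · simp [sn]
  · rw [mem_singleton_iff.1 hx, sn, show (j : ℝ) * (2 * Real.pi) / 2 = j * Real.pi by ring]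
    exact Real.sin_int_mul_pi j

theorem series_ssM_eq_zero {c : ℕ+ × ℕ+ → ℝ} (hc : Summable fun k => c k ^ 2) (ψ : H4)
    {p : ℝ × ℝ} (hp : p ∈ frontier Ω) : series c hc ssM norm_ssM_le ψ p = 0 := by
  have h : ∀ k, ssM k p = 0 := fun k => by
    rw [Ω, frontier_prod_eq] at hp
    rw [ssM, ssB_apply]
    rcases hp with hp | hp
    · rw [sn_eq_zero_of_mem_frontier hp.2, mul_zero]
    · rw [sn_eq_zero_of_mem_frontier hp.1, zero_mul]
  rw [series_apply]
  simp [h]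

theorem isSteadySolution_of_viscous_add {θ : H4} {ν μ : ℝ}
    (h : viscous ν μ θ + (advect θ + jacC θ (lap θ)) = 0) :
    IsSteadySolution (toBCF (base + θ)) ν μ := by
  refine ⟨(toBCF (base + θ)).continuous.continuousOn, fun p hp => series_ssM_eq_zero _ _ hp,
    lapBCF (base + θ), synS (cfl θ), synS (cfbl θ), jac (base + θ) (lap (base + θ)),
    (hasWeakLaplacian_toBCF ae_eq_rfl).congr_right (lapBCF_ae _),
    (lapBCF (base + θ)).continuous.continuousOn, fun p hp => series_ssM_eq_zero _ _ hp,
    hasJacobian_jac ae_eq_rfl ?_, hasWeakLaplacian_toBCF (Eventually.of_forall fun p => ?_),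
    hasWeakLaplacian_cfl ae_eq_rfl, ?_⟩
  · rw [vorS_lap]; exact lapBCF_ae _
  · simp only [map_add, BoundedContinuousFunction.coe_add, Pi.add_apply, toBCF_base]
    ring
  · rw [← synS_jacC, jacC_base_add]
    exact synS_add_eq_zero_iff.2 h

/-- The complement is a hyperplane, hence the kernel of a linear functional, which is continuous
because its kernel is closed. -/
theorem exists_functional_of_isCompl {ψ : H4} (hψ : ψ ≠ 0) {Z : Submodule ℝ H4}
    (hZclosed : IsClosed (Z : Set H4)) (hZ : IsCompl (Submodule.span ℝ {ψ}) Z) :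
    ∃ ℓ : H4 →L[ℝ] ℝ, ℓ ψ ≠ 0 ∧ ∀ x, ℓ x = 0 ↔ x ∈ Z := by
  have hψZ : ψ ∉ Z := fun h => hψ <| by
    have := Submodule.disjoint_def.1 hZ.disjoint ψ (Submodule.mem_span_singleton_self ψ) h
    exact this
  obtain ⟨f, hf, hfZ⟩ := Submodule.exists_le_ker_of_notMem hψZ
  have hker : ∀ x, f x = 0 ↔ x ∈ Z := fun x => by
    refine ⟨fun hx => ?_, fun hx => hfZ hx⟩
    have hx' : x ∈ Submodule.span ℝ {ψ} ⊔ Z := by rw [hZ.sup_eq_top]; trivial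
    obtain ⟨y, hy, z, hz, rfl⟩ := Submodule.mem_sup.1 hx'
    obtain ⟨r, rfl⟩ := Submodule.mem_span_singleton.1 hy
    have hz0 : f z = 0 := hfZ hz
    rw [map_add, hz0, add_zero, map_smul, smul_eq_mul] at hx
    rw [(mul_eq_zero.1 hx).resolve_right hf, zero_smul, zero_add]
    exact hz
  have hk : f.ker = Z := by
    ext x
    exact hker x
  have hc : Continuous f := f.continuous_iff_isClosed_ker.2 (by rw [hk]; exact hZclosed)
  exact ⟨⟨f, hc⟩, hf, hker⟩

end VortexFlow

/-! ### The branch of steady flows -/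

theorem theorem3 (ψc : H4) (νc μc : ℝ) (hν : 0 < νc) (hμ : 0 ≤ μc)
    (hspec : IsSpectralSolution 0 ψc νc μc)
    (hE : ψc ∈ E1 ∨ ψc ∈ E2 ∨ ψc ∈ E3)
    (Z : Submodule ℝ H4) (hZclosed : IsClosed (Z : Set H4))
    (hZ : IsCompl (Submodule.span ℝ {ψc}) Z) :
    ∃ (a : ℝ) (κ : ℝ → ℝ) (Ψ : ℝ → H4),
      0 < a ∧
      ContinuousOn κ (Set.Ioo (-a) a) ∧ ContinuousOn Ψ (Set.Ioo (-a) a) ∧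
      κ 0 = 0 ∧ Ψ 0 = 0 ∧
      ∀ ε ∈ Set.Ioo (-a) a,
        Ψ ε ∈ Z ∧
        IsSteadySolution
          (fun p => psi0 p + ε * toFun ψc p + ε * toFun (Ψ ε) p)
          (νc + νc * κ ε) (μc + μc * κ ε) := by
  have hψ : ψc ≠ 0 := hspec.1
  have hcrit := hspec.viscous_add_advect
  obtain ⟨S, hP, h22⟩ := exists_flowSymmetry hE
  obtain ⟨ℓ, hℓψ, hℓ⟩ := exists_functional_of_isCompl hψ hZclosed hZ
  -- The projection confines solutions to the class of `ψ_c`; on the whole of `H⁴` the kernel is not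
  -- controlled. Inside the class it has no effect, so no equation is lost.
  let V : H4 →L[ℝ] H4 := S.proj.comp (viscousInv hν hμ)
  let C : H4 →L[ℝ] H4 := V.comp advect
  let M : H4 →L[ℝ] H4 →L[ℝ] H4 := (ContinuousLinearMap.compL ℝ H4 H4 H4 V).comp
    (jacC.bilinearComp (ContinuousLinearMap.id ℝ H4) lap)
  have hCa : ∀ φ, C φ = S.proj (viscousInv hν hμ (advect φ)) := fun _ => rfl
  have hMa : ∀ φ, M φ φ = S.proj (viscousInv hν hμ (jacC φ (lap φ))) := fun _ => rfl
  have hC : IsCompactOperator C :=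
    (((isCompactOperator_jac base).comp_clm twoAddLap).clm_comp anS).clm_comp V
  have hVP : ∀ φ, S.proj φ = φ → S.proj (viscousInv hν hμ φ) = viscousInv hν hμ φ := fun φ hφ => by
    rw [viscousInv, S.proj_diag, hφ]
  have hCP : ∀ φ, S.proj φ = φ → C φ = viscousInv hν hμ (advect φ) := fun φ hφ => by
    rw [hCa, hVP _ (S.proj_advect hφ)]
  have hMP : ∀ φ, S.proj φ = φ → M φ φ = viscousInv hν hμ (jacC φ (lap φ)) := fun φ hφ => by
    rw [hMa, hVP _ (S.proj_jacC hφ (by rw [lap, S.proj_diag, hφ]))]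
  have hψC : ψc + C ψc = 0 := by
    rw [hCP ψc hP, eq_neg_of_add_eq_zero_right hcrit, map_neg, viscousInv_viscous, add_neg_cancel]
  obtain ⟨a, κ, Ψ, ha, hκ, hΨ, hκ0, hΨ0, hsol⟩ := exists_bifurcation_branch hC M ψc ℓ hψC
    fun Ψ κ h1 h2 => by
      -- The equation expresses `Ψ` through the range of the projection and `ψ_c`, so `Ψ` lies in
      -- the class.
      have hΨP : S.proj Ψ = Ψ := by
        have h3 : Ψ = -C Ψ - κ • ψc := by
          rw [eq_sub_iff_add_eq, eq_neg_iff_add_eq_zero, ← h1]; abel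
        rw [h3, map_sub, map_neg, map_smul, hP, hCa, S.proj_proj]
      have h4 := congrArg (viscous νc μc) h1
      rw [hCP Ψ hΨP, map_add, map_add, map_smul, viscous_viscousInv, map_zero] at h4
      obtain ⟨hκ, r, hr⟩ := S.kernel_and_transversality hν hμ hψ hP h22 hcrit hΨP h4
      rw [hr, map_smul, smul_eq_mul] at h2
      rw [hr, (mul_eq_zero.1 h2).resolve_right hℓψ, zero_smul]
      exact ⟨rfl, hκ⟩
  refine ⟨a, κ, Ψ, ha, hκ, hΨ, hκ0, hΨ0, fun ε hε => ?_⟩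
  obtain ⟨h1, h2, h3⟩ := hsol ε hε
  refine ⟨(hℓ _).1 h1, ?_⟩
  set φ := ψc + Ψ ε with hφ
  -- Likewise `(1 + κ)φ` lies in the range of the projection, and `1 + κ ≠ 0`.
  have hφP : S.proj φ = φ := by
    have h4 : (1 + κ ε) • φ = -C φ - ε • M φ φ := by
      rw [eq_sub_iff_add_eq, eq_neg_iff_add_eq_zero, ← h3]; abel
    have h5 : (1 + κ ε) • S.proj φ = (1 + κ ε) • φ := by
      rw [← map_smul, h4, map_sub, map_neg, map_smul, hCa, hMa, S.proj_proj, S.proj_proj]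
    exact smul_right_injective H4 h2.ne' h5
  have h4 := congrArg (viscous νc μc) h3
  rw [hCP φ hφP, hMP φ hφP, map_add, map_add, map_smul, map_smul, viscous_viscousInv,
    viscous_viscousInv, map_zero] at h4
  have h5 : viscous (νc + νc * κ ε) (μc + μc * κ ε) (ε • φ) +
      (advect (ε • φ) + jacC (ε • φ) (lap (ε • φ))) = 0 := by
    have h6 : viscous (νc + νc * κ ε) (μc + μc * κ ε) φ = (1 + κ ε) • viscous νc μc φ := by
      simp only [viscous_eq]
      module
    -- Multiplication by `ε` restores the equation for `εφ`, as the Jacobian term is quadratic.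
    have h7 := congrArg (fun x => ε • x) h4
    simp only [smul_zero] at h7
    simp only [map_smul, _root_.smul_apply, h6]
    rw [← h7]
    module
  have h6 := isSteadySolution_of_viscous_add h5
  convert h6 using 1
  funext p
  rw [hφ, ← toBCF_base]
  simp only [map_add, map_smul, BoundedContinuousFunction.coe_add, Pi.add_apply,
    BoundedContinuousFunction.coe_smul, toBCF_apply, smul_eq_mul]
  ring
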